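/- Let $n\ge 0$, $V=\mathbb{C}^{n+1}$ with basis $e_0,\dots,e_n$, and $\mathbb{P}^n=\mathbb{P}(V)$ the space of lines in $V$. Let $t=\sum_{i,j}T_{ij}e_ie_j\in S^2V$ be a quadric tensor, $T$ a symmetric complex matrix, of rank $k=\operatorname{rank}T\ge 2$, and let $P=t^\perp\subset S^2V^\vee$ be the hyperplane of the quadratic forms $q$ whose contraction $\sum_{i,j}T_{ij}\,\partial_i\partial_j q$ with $t$ is zero. Let $\mathcal{E}_P$ be the cokernel of the morphism $\mathcal{O}_{\mathbb{P}^n}(-2)\to P^\vee\otimes\mathcal{O}_{\mathbb{P}^n}$ given by evaluation of the forms of $P$, that is, at the point $[v]$ it sends $v^2$ to the linear form $q\mapsto q(v)$. Then $\mathcal{E}_P$ is an ordinary Drézet bundle: with $e=\dim P-1$, it is a vector bundle of rank $e$ that fits into an exact sequence $$0\to\mathcal{O}_{\mathbb{P}^n}(-2)\to\mathcal{O}_{\mathbb{P}^n}^{\oplus e+1}\to\mathcal{E}_P\to 0,$$ and $H^1(\mathbb{P}^n,\mathcal{E}_P^\vee(1))=0$. Moreover $\mathcal{E}_P^\vee(1)$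 is generated by global sections if and only if $k>2$. -/

import Mathlib

open TopologicalSpace Module

noncomputable section

namespace Drezet

/-- Complex projective space `ℙⁿ = ℙ(V)`, `V = ℂⁿ⁺¹`: the set of lines of `V`
(a classical variety: its points are the closed points). -/
abbrev PP (n : ℕ) : Type := Projectivization ℂ (Fin (n + 1) → ℂ)

/-- The line of `V` that corresponds to a point of `ℙ(V)`. -/
def line {n : ℕ} (x : PP n) : Submodule ℂ (Fin (n + 1) → ℂ) := Projectivization.submodule x

/-- The nonzero vectors of the line `x`. -/
abbrev Punct {n : ℕ} (x : PP n) : Type := {v : Fin (n + 1) → ℂ // v ∈ line x ∧ v ≠ 0}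

/-- A chosen nonzero vector of the line `x`. -/
def rep {n : ℕ} (x : PP n) : Punct x :=
  ⟨Projectivization.rep x, by
    rw [line, Projectivization.submodule_eq]
    exact Submodule.mem_span_singleton_self _, Projectivization.rep_nonzero x⟩

/-- The value at a vector of `V` of a polynomial in the coordinates. -/
abbrev val {n : ℕ} (f : MvPolynomial (Fin (n + 1)) ℂ) (v : Fin (n + 1) → ℂ) : ℂ :=
  MvPolynomial.eval v f

theorem exists_smul_eq {n : ℕ} {x : PP n} (v w : Punct x) : ∃ c : ℂ, c • v.1 = w.1 := by
  have key : ∀ u : Punct x, ∃ c : ℂ, c • (rep x).1 = u.1 := fun u => by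
    have hu : u.1 ∈ Submodule.span ℂ {Projectivization.rep x} := by
      rw [← Projectivization.submodule_eq]
      exact u.2.1
    exact Submodule.mem_span_singleton.1 hu
  obtain ⟨c, hc⟩ := key v
  obtain ⟨d, hd⟩ := key w
  have hc0 : c ≠ 0 := by
    rintro rfl
    exact v.2.2 (by simpa using hc.symm)
  exact ⟨d * c⁻¹, by rw [← hc, smul_smul, inv_mul_cancel_right₀ hc0, hd]⟩

theorem val_smul {n d : ℕ} {f : MvPolynomial (Fin (n + 1)) ℂ} (hf : f.IsHomogeneous d) (c : ℂ)
    (v : Fin (n + 1) → ℂ) : val f (c • v) = c ^ d * val f v := by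
  simp only [val, MvPolynomial.eval_eq, Finset.mul_sum]
  refine Finset.sum_congr rfl fun m hm => ?_
  have hdeg : ∑ i ∈ m.support, m i = d := by
    have := hf (MvPolynomial.mem_support_iff.1 hm)
    rw [Pi.one_def, ← Finsupp.degree_eq_weight_one] at this
    exact this
  simp only [Pi.smul_apply, smul_eq_mul, mul_pow, Finset.prod_mul_distrib,
    Finset.prod_pow_eq_pow_sum, hdeg]
  ring

theorem quot_eq {n d : ℕ} {a b : MvPolynomial (Fin (n + 1)) ℂ} (ha : a.IsHomogeneous d)
    (hb : b.IsHomogeneous d) {x : PP n} (v w : Punct x) :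
    val a v / val b v = val a w / val b w := by
  obtain ⟨c, hc⟩ := exists_smul_eq v w
  have hc0 : c ≠ 0 := by
    rintro rfl
    exact w.2.2 (by simpa using hc.symm)
  rw [← hc, val_smul ha, val_smul hb, mul_div_mul_left _ _ (pow_ne_zero d hc0)]

/-- The Zariski topology: its basic open sets are the `D(f)`, `f` homogeneous. -/
instance zariski (n : ℕ) : TopologicalSpace (PP n) :=
  generateFrom {D | ∃ (d : ℕ) (f : MvPolynomial (Fin (n + 1)) ℂ),
    f.IsHomogeneous d ∧ D = {x | ∀ v : Punct x, val f v ≠ 0}}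

/-- Regular functions: locally `a / b` with `a`, `b` homogeneous of the same degree. -/
def IsRegular {n : ℕ} {U : Opens (PP n)} (φ : U → ℂ) : Prop :=
  ∀ x : U, ∃ (W : Opens (PP n)) (h : W ≤ U), x.1 ∈ W ∧
    ∃ (d : ℕ) (a b : MvPolynomial (Fin (n + 1)) ℂ), a.IsHomogeneous d ∧ b.IsHomogeneous d ∧
      ∀ (y : W) (v : Punct y.1), val b v ≠ 0 ∧ φ ⟨y, h y.2⟩ = val a v / val b v

theorem IsRegular.const {n : ℕ} {U : Opens (PP n)} (c : ℂ) : IsRegular (fun _ : U => c) := by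
  intro x
  refine ⟨U, le_rfl, x.2, 0, MvPolynomial.C c, 1, MvPolynomial.isHomogeneous_C _ _,
    MvPolynomial.isHomogeneous_one _ _, fun y v => ?_⟩
  simp [val]

theorem IsRegular.add {n : ℕ} {U : Opens (PP n)} {φ ψ : U → ℂ} (hφ : IsRegular φ)
    (hψ : IsRegular ψ) : IsRegular (fun x => φ x + ψ x) := by
  intro x
  obtain ⟨W, h, hx, d, a, b, ha, hb, H⟩ := hφ x
  obtain ⟨W', h', hx', d', a', b', ha', hb', H'⟩ := hψ x
  refine ⟨W ⊓ W', inf_le_left.trans h, ⟨hx, hx'⟩, d + d', a * b' + b * a', b * b',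
    (ha.mul hb').add (hb.mul ha'), hb.mul hb', fun y v => ?_⟩
  obtain ⟨h1, h2⟩ := H ⟨y, y.2.1⟩ v
  obtain ⟨h3, h4⟩ := H' ⟨y, y.2.2⟩ v
  refine ⟨by simpa [val] using ⟨h1, h3⟩, ?_⟩
  simp only at h2 h4
  simp only [h2, h4, val, map_add, map_mul]
  exact div_add_div _ _ h1 h3

theorem IsRegular.mul {n : ℕ} {U : Opens (PP n)} {φ ψ : U → ℂ} (hφ : IsRegular φ)
    (hψ : IsRegular ψ) : IsRegular (fun x => φ x * ψ x) := by
  intro x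
  obtain ⟨W, h, hx, d, a, b, ha, hb, H⟩ := hφ x
  obtain ⟨W', h', hx', d', a', b', ha', hb', H'⟩ := hψ x
  refine ⟨W ⊓ W', inf_le_left.trans h, ⟨hx, hx'⟩, d + d', a * a', b * b',
    ha.mul ha', hb.mul hb', fun y v => ?_⟩
  obtain ⟨h1, h2⟩ := H ⟨y, y.2.1⟩ v
  obtain ⟨h3, h4⟩ := H' ⟨y, y.2.2⟩ v
  refine ⟨by simpa [val] using ⟨h1, h3⟩, ?_⟩
  simp only at h2 h4
  simp only [h2, h4, val, map_mul]
  exact div_mul_div_comm _ _ _ _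

theorem IsRegular.res {n : ℕ} {U W : Opens (PP n)} (h : W ≤ U) {φ : U → ℂ} (hφ : IsRegular φ) :
    IsRegular (fun x : W => φ ⟨x, h x.2⟩) := by
  intro x
  obtain ⟨W', h', hx', d, a, b, ha, hb, H⟩ := hφ ⟨x, h x.2⟩
  exact ⟨W ⊓ W', inf_le_left, ⟨x.2, hx'⟩, d, a, b, ha, hb, fun y v => H ⟨y, y.2.2⟩ v⟩

theorem IsRegular.of_local {n : ℕ} {U : Opens (PP n)} {φ : U → ℂ}
    (hφ : ∀ x : U, ∃ (W : Opens (PP n)) (h : W ≤ U), x.1 ∈ W ∧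
      IsRegular (fun y : W => φ ⟨y, h y.2⟩)) : IsRegular φ := by
  intro x
  obtain ⟨W, h, hx, H⟩ := hφ x
  obtain ⟨W', h', hx', d, a, b, ha, hb, H'⟩ := H ⟨x, hx⟩
  exact ⟨W', h'.trans h, hx', d, a, b, ha, hb, H'⟩

/-- A family of complex vector spaces over `ℙⁿ` together with its sheaf of regular sections,
a sheaf of modules over the regular functions. Vector bundles are the locally trivial ones, see
`Fam.IsVectorBundle`. -/
structure Fam (n : ℕ) where
  /-- the fibres -/
  fib : PP n → Type
  [addCommGroup : ∀ x, AddCommGroup (fib x)]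
  [module : ∀ x, Module ℂ (fib x)]
  /-- the regular sections over an open set -/
  reg : ∀ U : Opens (PP n), Submodule ℂ (∀ x : U, fib x)
  smul_mem : ∀ (U : Opens (PP n)) (φ : U → ℂ) (s : ∀ x : U, fib x), IsRegular φ → s ∈ reg U →
    (fun x => φ x • s x) ∈ reg U
  res_mem : ∀ (U W : Opens (PP n)) (h : W ≤ U) (s : ∀ x : U, fib x), s ∈ reg U →
    (fun x : W => s ⟨x, h x.2⟩) ∈ reg W
  local_mem : ∀ (U : Opens (PP n)) (s : ∀ x : U, fib x),
    (∀ x : U, ∃ (W : Opens (PP n)) (h : W ≤ U), x.1 ∈ W ∧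
      (fun y : W => s ⟨y, h y.2⟩) ∈ reg W) → s ∈ reg U

attribute [instance] Fam.addCommGroup Fam.module

namespace Fam

variable {n : ℕ}

/-- A vector bundle of rank `e`: locally there are `e` regular sections that form a basis of every
fibre and a basis of the module of regular sections over every smaller open set. -/
def IsVectorBundle (E : Fam n) (e : ℕ) : Prop :=
  ∀ x : PP n, ∃ U : Opens (PP n), x ∈ U ∧ ∃ s : Fin e → ∀ y : U, E.fib y,
    (∀ i, s i ∈ E.reg U) ∧
    (∀ y : U, LinearIndependent ℂ (fun i => s i y) ∧
      Submodule.span ℂ (Set.range fun i => s i y) = ⊤) ∧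
    ∀ (W : Opens (PP n)) (h : W ≤ U), ∀ t ∈ E.reg W, ∃ φ : Fin e → W → ℂ,
      (∀ i, IsRegular (φ i)) ∧ ∀ y : W, t y = ∑ i, φ i y • s i ⟨y, h y.2⟩

/-- A morphism: linear on the fibres, and it sends regular sections to regular sections. -/
structure Hom (E F : Fam n) where
  /-- the map on fibres -/
  app : ∀ x, E.fib x →ₗ[ℂ] F.fib x
  reg : ∀ (U : Opens (PP n)), ∀ s ∈ E.reg U, (fun x : U => app x (s x)) ∈ F.reg U

/-- The trivial family `W ⊗ 𝒪`, for a finite dimensional vector space `W`: a section is a map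
to `W`, regular if its composition with every linear form is. -/
def trivial (n : ℕ) (W : Type) [AddCommGroup W] [Module ℂ W] : Fam n where
  fib _ := W
  reg U :=
    { carrier := {s | ∀ ℓ : Dual ℂ W, IsRegular (fun x : U => ℓ (s x))}
      zero_mem' := fun ℓ => by simpa using IsRegular.const 0
      add_mem' := fun {s t} hs ht ℓ => by simpa using (hs ℓ).add (ht ℓ)
      smul_mem' := fun c s hs ℓ => by simpa using (IsRegular.const c).mul (hs ℓ) }
  smul_mem := fun U φ s hφ hs ℓ => by simpa using hφ.mul (hs ℓ)
  res_mem := fun U W' h s hs ℓ => (hs ℓ).res h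
  local_mem := fun U s H ℓ => IsRegular.of_local fun x => by
    obtain ⟨W', h, hx, H'⟩ := H x
    exact ⟨W', h, hx, H' ℓ⟩

/-- The dual `E^∨`: a section is regular if its pairing with the regular local sections of `E`
gives regular functions. -/
def dual (E : Fam n) : Fam n where
  fib x := Dual ℂ (E.fib x)
  reg U :=
    { carrier := {s | ∀ (W : Opens (PP n)) (h : W ≤ U), ∀ t ∈ E.reg W,
        IsRegular (fun x : W => s ⟨x, h x.2⟩ (t x))}
      zero_mem' := fun W h t _ => by simpa using IsRegular.const 0
      add_mem' := fun {s s'} hs hs' W h t ht => by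
        simpa using (hs W h t ht).add (hs' W h t ht)
      smul_mem' := fun c s hs W h t ht => by
        simpa using (IsRegular.const c).mul (hs W h t ht) }
  smul_mem := fun U φ s hφ hs W h t ht => by simpa using (hφ.res h).mul (hs W h t ht)
  res_mem := fun U W' h s hs W h' t ht => hs W (h'.trans h) t ht
  local_mem := fun U s H W h t ht => IsRegular.of_local fun x => by
    obtain ⟨W', h', hx, H'⟩ := H ⟨x, h x.2⟩
    exact ⟨W ⊓ W', inf_le_left, ⟨x.2, hx⟩, H' (W ⊓ W') inf_le_right _
      (E.res_mem W (W ⊓ W') inf_le_left t ht)⟩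

/-- The fibre at `x` of `E(d)`: the maps from the nonzero vectors of the line `x` to the fibre of
`E` that are homogeneous of degree `d`, that is, `E_x` tensored with the `d`-th power of the dual
of the line. -/
def twistFib (E : Fam n) (d : ℤ) (x : PP n) : Submodule ℂ (Punct x → E.fib x) where
  carrier := {φ | ∀ (c : ℂ) (v w : Punct x), w.1 = c • v.1 → φ w = c ^ d • φ v}
  zero_mem' := fun c v w _ => by simp
  add_mem' := fun {φ ψ} hφ hψ c v w h => by simp [hφ c v w h, hψ c v w h]
  smul_mem' := fun a φ hφ c v w h => by simp [hφ c v w h, smul_comm a]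

/-- A section of `E(d)` is regular if it is locally the product of a regular section of `E` with
a local generator `a / b` of `𝒪(d)`: `a`, `b` homogeneous without zeros,
`deg a - deg b = d`. -/
def IsTwistReg (E : Fam n) (d : ℤ) (U : Opens (PP n)) (s : ∀ x : U, E.twistFib d x) : Prop :=
  ∀ x : U, ∃ (W : Opens (PP n)) (h : W ≤ U), x.1 ∈ W ∧
    ∃ (p q : ℕ) (a b : MvPolynomial (Fin (n + 1)) ℂ), (p : ℤ) - q = d ∧
      a.IsHomogeneous p ∧ b.IsHomogeneous q ∧
      ∃ t ∈ E.reg W, ∀ (y : W) (v : Punct y.1), val a v ≠ 0 ∧ val b v ≠ 0 ∧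
        (s ⟨y, h y.2⟩).1 v = (val a v / val b v) • t y

theorem IsTwistReg.add {E : Fam n} {d : ℤ} {U : Opens (PP n)} {s s' : ∀ x : U, E.twistFib d x}
    (hs : E.IsTwistReg d U s) (hs' : E.IsTwistReg d U s') : E.IsTwistReg d U (s + s') := by
  intro x
  obtain ⟨W, h, hx, p, q, a, b, hpq, ha, hb, t, ht, H⟩ := hs x
  obtain ⟨W', h', hx', p', q', a', b', hpq', ha', hb', t', ht', H'⟩ := hs' x
  have hdeg : b' * a |>.IsHomogeneous (p' + q) := by
    have := hb'.mul ha
    rwa [show q' + p = p' + q by omega] at this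
  have hne : ∀ (y : (W ⊓ W' : Opens (PP n))) (v : Punct y.1), val (b' * a) v ≠ 0 := by
    intro y v
    obtain ⟨h1, -, -⟩ := H ⟨y, y.2.1⟩ v
    obtain ⟨-, h2, -⟩ := H' ⟨y, y.2.2⟩ v
    simpa [val] using ⟨h2, h1⟩
  have hreg : IsRegular (fun y : (W ⊓ W' : Opens (PP n)) =>
      val (a' * b) (rep y.1) / val (b' * a) (rep y.1)) := fun y =>
    ⟨W ⊓ W', le_rfl, y.2, p' + q, a' * b, b' * a, ha'.mul hb, hdeg, fun z v =>
      ⟨hne z v, quot_eq (ha'.mul hb) hdeg _ _⟩⟩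
  refine ⟨W ⊓ W', inf_le_left.trans h, ⟨hx, hx'⟩, p, q, a, b, hpq, ha, hb, _,
    (E.reg (W ⊓ W')).add_mem (E.res_mem W _ inf_le_left t ht)
      (E.smul_mem _ _ _ hreg (E.res_mem W' _ inf_le_right t' ht')), fun y v => ?_⟩
  obtain ⟨h1, h2, h3⟩ := H ⟨y, y.2.1⟩ v
  obtain ⟨h4, h5, h6⟩ := H' ⟨y, y.2.2⟩ v
  refine ⟨h1, h2, ?_⟩
  simp only at h3 h6
  simp only [Pi.add_apply, Submodule.coe_add, smul_add, h3, h6, smul_smul]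
  rw [quot_eq (ha'.mul hb) hdeg (rep y.1) v]
  congr 2
  simp only [val, map_mul]
  simp only [val] at h1 h2 h4 h5
  field_simp

theorem IsTwistReg.zero (E : Fam n) (d : ℤ) (U : Opens (PP n)) :
    E.IsTwistReg d U 0 := by
  intro x
  obtain ⟨i, hi⟩ : ∃ i, (rep x.1).1 i ≠ 0 := by
    by_contra! hcon
    exact (rep x.1).2.2 (funext hcon)
  let D : Opens (PP n) := ⟨{y | ∀ v : Punct y, val (MvPolynomial.X i) v ≠ 0},
    isOpen_generateFrom_of_mem ⟨1, MvPolynomial.X i, MvPolynomial.isHomogeneous_X _ _, rfl⟩⟩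
  have hD : x.1 ∈ D := by
    intro v
    obtain ⟨c, hc⟩ := exists_smul_eq (rep x.1) v
    have hc0 : c ≠ 0 := by
      rintro rfl
      exact v.2.2 (by simpa using hc.symm)
    simpa [val, ← hc] using ⟨hc0, hi⟩
  refine ⟨U ⊓ D, inf_le_left, ⟨x.2, hD⟩, d.toNat, (-d).toNat, MvPolynomial.X i ^ d.toNat,
    MvPolynomial.X i ^ (-d).toNat, by omega, MvPolynomial.isHomogeneous_X_pow _ _,
    MvPolynomial.isHomogeneous_X_pow _ _, 0, Submodule.zero_mem _, fun y v => ?_⟩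
  have := y.2.2 v
  simp only [val, MvPolynomial.eval_X] at this
  exact ⟨by simp [val, this], by simp [val, this], by simp⟩

theorem IsTwistReg.smul {E : Fam n} {d : ℤ} {U : Opens (PP n)} {s : ∀ x : U, E.twistFib d x}
    (hs : E.IsTwistReg d U s) {φ : U → ℂ} (hφ : IsRegular φ) :
    E.IsTwistReg d U (fun x => φ x • s x) := by
  intro x
  obtain ⟨W, h, hx, p, q, a, b, hpq, ha, hb, t, ht, H⟩ := hs x
  refine ⟨W, h, hx, p, q, a, b, hpq, ha, hb, _, E.smul_mem W _ t (hφ.res h) ht, fun y v => ?_⟩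
  obtain ⟨h1, h2, h3⟩ := H y v
  refine ⟨h1, h2, ?_⟩
  simp only [Submodule.coe_smul, Pi.smul_apply, h3]
  exact smul_comm _ _ _

/-- The twist `E(d) = E ⊗ 𝒪(d)`. -/
def twist (E : Fam n) (d : ℤ) : Fam n where
  fib x := E.twistFib d x
  reg U :=
    { carrier := {s | E.IsTwistReg d U s}
      zero_mem' := IsTwistReg.zero E d U
      add_mem' := fun hs ht => IsTwistReg.add hs ht
      smul_mem' := fun c _ hs => IsTwistReg.smul hs (IsRegular.const c) }
  smul_mem := fun _ _ _ hφ hs => IsTwistReg.smul hs hφ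
  res_mem := fun U W h s hs x => by
    obtain ⟨W', h', hx', p, q, a, b, hpq, ha, hb, t, ht, H⟩ := hs ⟨x, h x.2⟩
    exact ⟨W ⊓ W', inf_le_left, ⟨x.2, hx'⟩, p, q, a, b, hpq, ha, hb, _,
      E.res_mem W' _ inf_le_right t ht, fun y v => H ⟨y, y.2.2⟩ v⟩
  local_mem := fun U s H x => by
    obtain ⟨W, h, hx, H'⟩ := H x
    obtain ⟨W', h', hx', p, q, a, b, hpq, ha, hb, t, ht, K⟩ := H' ⟨x, hx⟩
    exact ⟨W', h'.trans h, hx', p, q, a, b, hpq, ha, hb, t, ht, K⟩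

/-- The line bundle `𝒪(d)`. -/
def O (n : ℕ) (d : ℤ) : Fam n := (trivial n ℂ).twist d

/-- The cokernel of a morphism: the quotients of the fibres, where a section is regular if it
locally lifts to a regular section. -/
def coker {E F : Fam n} (α : Hom E F) : Fam n where
  fib x := F.fib x ⧸ LinearMap.range (α.app x)
  reg U :=
    { carrier := {s | ∀ x : U, ∃ (W : Opens (PP n)) (h : W ≤ U), x.1 ∈ W ∧
        ∃ t ∈ F.reg W, ∀ y : W, s ⟨y, h y.2⟩ = Submodule.Quotient.mk (t y)}
      zero_mem' := fun x => ⟨U, le_rfl, x.2, 0, Submodule.zero_mem _, fun y => by simp⟩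
      add_mem' := fun {s s'} hs hs' x => by
        obtain ⟨W, h, hx, t, ht, H⟩ := hs x
        obtain ⟨W', h', hx', t', ht', H'⟩ := hs' x
        refine ⟨W ⊓ W', inf_le_left.trans h, ⟨hx, hx'⟩, _,
          (F.reg _).add_mem (F.res_mem W _ inf_le_left t ht)
            (F.res_mem W' _ inf_le_right t' ht'), fun y => ?_⟩
        have h1 := H ⟨y, y.2.1⟩
        have h2 := H' ⟨y, y.2.2⟩
        simp only at h1 h2
        simp [h1, h2]
      smul_mem' := fun c s hs x => by
        obtain ⟨W, h, hx, t, ht, H⟩ := hs x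
        exact ⟨W, h, hx, c • t, (F.reg W).smul_mem c ht, fun y => by simp [H y]⟩ }
  smul_mem := fun U φ s hφ hs x => by
    obtain ⟨W, h, hx, t, ht, H⟩ := hs x
    exact ⟨W, h, hx, _, F.smul_mem W _ t (hφ.res h) ht, fun y => by simp [H y]⟩
  res_mem := fun U W h s hs x => by
    obtain ⟨W', h', hx', t, ht, H⟩ := hs ⟨x, h x.2⟩
    exact ⟨W ⊓ W', inf_le_left, ⟨x.2, hx'⟩, _, F.res_mem W' _ inf_le_right t ht,
      fun y => H ⟨y, y.2.2⟩⟩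
  local_mem := fun U s H x => by
    obtain ⟨W, h, hx, H'⟩ := H x
    obtain ⟨W', h', hx', t, ht, K⟩ := H' ⟨x, hx⟩
    exact ⟨W', h'.trans h, hx', t, ht, K⟩

/-- Generated by global sections: at every point the global regular sections span the fibre. -/
def IsGloballyGenerated (E : Fam n) : Prop :=
  ∀ x : PP n, Submodule.span ℂ
    {e : E.fib x | ∃ s ∈ E.reg ⊤, s ⟨x, Opens.mem_top x⟩ = e} = ⊤

/-- The Čech 1-cocycles of a family of open sets with values in the sheaf of regular sections. -/
def cocycles (E : Fam n) {ι : Type} (U : ι → Opens (PP n)) :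
    Submodule ℂ (∀ (i j : ι) (x : (U i ⊓ U j : Opens (PP n))), E.fib x) where
  carrier := {g | (∀ i j, g i j ∈ E.reg (U i ⊓ U j)) ∧
    ∀ (i j k : ι) (x : PP n) (hi : x ∈ U i) (hj : x ∈ U j) (hk : x ∈ U k),
      g i j ⟨x, hi, hj⟩ + g j k ⟨x, hj, hk⟩ = g i k ⟨x, hi, hk⟩}
  zero_mem' := ⟨fun _ _ => Submodule.zero_mem _, fun i j k x hi hj hk => by simp⟩
  add_mem' := fun {g g'} hg hg' => ⟨fun i j => Submodule.add_mem _ (hg.1 i j) (hg'.1 i j),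
    fun i j k x hi hj hk => by
      simp only [Pi.add_apply]
      rw [← hg.2 i j k x hi hj hk, ← hg'.2 i j k x hi hj hk]
      abel⟩
  smul_mem' := fun c g hg => ⟨fun i j => Submodule.smul_mem _ c (hg.1 i j),
    fun i j k x hi hj hk => by
      simp only [Pi.smul_apply]
      rw [← hg.2 i j k x hi hj hk, smul_add]⟩

/-- The Čech 1-coboundaries. -/
def coboundaries (E : Fam n) {ι : Type} (U : ι → Opens (PP n)) :
    Submodule ℂ (∀ (i j : ι) (x : (U i ⊓ U j : Opens (PP n))), E.fib x) where
  carrier := {g | ∃ f : ∀ (i : ι) (x : U i), E.fib x, (∀ i, f i ∈ E.reg (U i)) ∧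
    ∀ (i j : ι) (x : PP n) (hi : x ∈ U i) (hj : x ∈ U j),
      g i j ⟨x, hi, hj⟩ = f j ⟨x, hj⟩ - f i ⟨x, hi⟩}
  zero_mem' := ⟨0, fun _ => Submodule.zero_mem _, fun i j x hi hj => by simp⟩
  add_mem' := by
    rintro g g' ⟨f, hf, h⟩ ⟨f', hf', h'⟩
    refine ⟨f + f', fun i => Submodule.add_mem _ (hf i) (hf' i), fun i j x hi hj => ?_⟩
    simp only [Pi.add_apply]
    rw [h i j x hi hj, h' i j x hi hj]
    abel
  smul_mem' := by
    rintro c g ⟨f, hf, h⟩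
    refine ⟨c • f, fun i => Submodule.smul_mem _ c (hf i), fun i j x hi hj => ?_⟩
    simp only [Pi.smul_apply]
    rw [h i j x hi hj, smul_sub]

/-- The Čech cohomology group `H¹(𝒰, E)`. -/
abbrev CechH1 (E : Fam n) {ι : Type} (U : ι → Opens (PP n)) : Type :=
  E.cocycles U ⧸ (E.coboundaries U).submoduleOf (E.cocycles U)

/-- `H¹(ℙⁿ, E) = 0`. For every sheaf on every space, `H¹` is the direct limit of the groups
`H¹(𝒰, E)` over the open covers `𝒰`, with injective transition maps; so it vanishes if and only
if all the `H¹(𝒰, E)` do. -/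
def H1Vanishes (E : Fam n) : Prop :=
  ∀ (ι : Type) (U : ι → Opens (PP n)), (⨆ i, U i) = ⊤ → Subsingleton (E.CechH1 U)

/-- A Drézet bundle of rank `e` on `ℙⁿ`: a vector bundle `E` with an exact sequence
`0 → 𝒪(-c) → 𝒪^{e+1} → E → 0`. -/
def IsDrezet (E : Fam n) (c e : ℕ) : Prop :=
  E.IsVectorBundle e ∧
    ∃ (i : Hom (O n (-c)) (trivial n (Fin (e + 1) → ℂ))) (p : Hom (trivial n (Fin (e + 1) → ℂ)) E),
      ∀ x, Function.Injective (i.app x) ∧ Function.Exact (i.app x) (p.app x) ∧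
        Function.Surjective (p.app x)

/-- An ordinary Drézet bundle: `H¹(E^∨(1)) = 0`. -/
def IsOrdinaryDrezet (E : Fam n) (c e : ℕ) : Prop :=
  E.IsDrezet c e ∧ (E.dual.twist 1).H1Vanishes

end Fam

variable {n : ℕ}

/-- `S^c V^∨`, the space of homogeneous polynomials of degree `c`. -/
abbrev Sym (n c : ℕ) : Submodule ℂ (MvPolynomial (Fin (n + 1)) ℂ) :=
  MvPolynomial.homogeneousSubmodule (Fin (n + 1)) ℂ c

theorem finiteDimensional_of_le_sym {c : ℕ} {P : Submodule ℂ (MvPolynomial (Fin (n + 1)) ℂ)}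
    (hP : P ≤ Sym n c) : FiniteDimensional ℂ P := by
  have h : P ≤ MvPolynomial.restrictTotalDegree (Fin (n + 1)) ℂ c := fun f hf => by
    rw [MvPolynomial.mem_restrictTotalDegree]
    exact ((MvPolynomial.mem_homogeneousSubmodule _ _).1 (hP hf)).totalDegree_le
  exact Submodule.finiteDimensional_of_le h

/-- At a point `x`, the map from the fibre of `𝒪(-c)` to `P^∨` that sends `φ` to the linear form
`q ↦ q(v) φ(v)` on `P`, where `v` is any nonzero vector of the line `x`: for `P` in `S^c V^∨` the
product does not depend on `v`. -/
def evalMap (P : Submodule ℂ (MvPolynomial (Fin (n + 1)) ℂ)) (c : ℕ) (x : PP n) :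
    (Fam.trivial n ℂ).twistFib (-c) x →ₗ[ℂ] Dual ℂ P :=
  LinearMap.mk₂ ℂ (fun (φ : (Fam.trivial n ℂ).twistFib (-c) x) (q : P) =>
      val q.1 (rep x) • φ.1 (rep x))
    (fun _ _ _ => smul_add _ _ _)
    (fun a φ q => mul_left_comm (val q.1 (rep x)) a (φ.1 (rep x)))
    (fun φ q r => by
      simp only [val, Submodule.coe_add, map_add]
      exact add_smul _ _ _)
    (fun a φ q => by
      simp only [val, Submodule.coe_smul, MvPolynomial.smul_eval]
      exact mul_smul _ _ _)

/-- The morphism `𝒪(-c) → P^∨ ⊗ 𝒪` defined by a space `P` of polynomials of degree `c`. -/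
def evalHom {c : ℕ} (P : Submodule ℂ (MvPolynomial (Fin (n + 1)) ℂ)) (hP : P ≤ Sym n c) :
    Fam.Hom (Fam.O n (-c)) (Fam.trivial n (Dual ℂ P)) where
  app := evalMap P c
  reg := fun U s hs ℓ => by
    have : FiniteDimensional ℂ P := finiteDimensional_of_le_sym hP
    obtain ⟨q, rfl⟩ := (Module.evalEquiv ℂ P).surjective ℓ
    refine IsRegular.of_local fun x => ?_
    obtain ⟨W, h, hx, p, m, a, b, hpm, ha, hb, t, ht, H⟩ := hs x
    have hq : q.1.IsHomogeneous c := (MvPolynomial.mem_homogeneousSubmodule _ _).1 (hP q.2)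
    have hdeg : (a * q.1).IsHomogeneous m := by
      have := ha.mul hq
      rwa [show p + c = m by omega] at this
    have hreg : IsRegular (fun y : W => val (a * q.1) (rep y.1) / val b (rep y.1)) := fun y =>
      ⟨W, le_rfl, y.2, m, a * q.1, b, hdeg, hb, fun z v =>
        ⟨(H z v).2.1, quot_eq hdeg hb _ _⟩⟩
    refine ⟨W, h, hx, ?_⟩
    convert hreg.mul (ht LinearMap.id) using 2 with y
    have key : ∀ A B Q z : ℂ, Q * (A / B * z) = A * Q / B * z := fun A B Q z => by ring
    change val q.1 (rep y.1) • (s ⟨y, h y.2⟩).1 (rep y.1) = _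
    rw [(H y (rep y.1)).2.2]
    simp only [val, map_mul]
    exact key _ _ _ _

/-- `E_P`, the cokernel of `𝒪(-c) → P^∨ ⊗ 𝒪`, for a subspace `P` of `S^c V^∨`. -/
def EP {c : ℕ} (P : Submodule ℂ (MvPolynomial (Fin (n + 1)) ℂ)) (hP : P ≤ Sym n c) : Fam n :=
  Fam.coker (evalHom P hP)

/-- The contraction of polynomials with the tensor `t = ∑ T i j e_i e_j` of `S²V`, where `e_i`
acts as the derivation by the `i`-th coordinate. -/
def contract (T : Matrix (Fin (n + 1)) (Fin (n + 1)) ℂ) :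
    MvPolynomial (Fin (n + 1)) ℂ →ₗ[ℂ] MvPolynomial (Fin (n + 1)) ℂ :=
  ∑ i, ∑ j, T i j •
    ((MvPolynomial.pderiv i).toLinearMap ∘ₗ (MvPolynomial.pderiv j).toLinearMap)

/-- The subspace of `S²V^∨` orthogonal to the tensor `t = ∑ T i j e_i e_j` of `S²V`. -/
def orth (T : Matrix (Fin (n + 1)) (Fin (n + 1)) ℂ) :
    Submodule ℂ (MvPolynomial (Fin (n + 1)) ℂ) :=
  Sym n 2 ⊓ LinearMap.ker (contract T)

theorem orth_le (T : Matrix (Fin (n + 1)) (Fin (n + 1)) ℂ) : orth T ≤ Sym n 2 := inf_le_left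

end Drezet

end

/-! Write P = t^⊥. At [v] the image of 𝒪(-2) → P^∨ ⊗ 𝒪 is spanned by evaluation at v. This is
nonzero: if all of P vanished at v, evaluation at v would be a multiple of the contraction with t,
so T would be proportional to v vᵀ and of rank one (`exists_mem_orth_val_ne_zero`). Hence E_P is a
vector bundle (`isDrezet_EP`). Dualizing and twisting gives 0 → E_P^∨(1) → P ⊗ 𝒪(1) → 𝒪(3) → 0: a
section of E_P^∨(1) is a map F of degree one from a cone to P with F(v)(v) = 0
(`exists_form_of_section`, `exists_section_of_form`).

Rank at least two forces n ≥ 1, so H¹(𝒪(1)) = 0 (`exists_isHomReg_eq_sub`) and H¹(E_P^∨(1)) is the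
cokernel of V^∨ ⊗ P → S³V^∨. If a linear form f on cubics kills the image, then f(X_i q) = c_i ⟨t,
q⟩ for every quadric q, and the symmetry c_i T_jk = c_j T_ik forces c = 0 or rank T ≤ 1
(`sym_three_le_range_mulMap`).

Global sections of E_P^∨(1) are linear syzygies ∑ X_i r_i = 0 with r_i in P. The fibre at [v]
consists of the quadrics of P through v, and the syzygy has value ∑ v_i r_i there. In rank at least
three, a dual form of the same symmetry argument shows that every such quadric is a value
(`exists_syzygy`). In rank two, t is proportional to a product ab of independent vectors, and
quadrics of P have no mixed term on the plane of a and b. Testing F(v)(v) = 0 at a + b and a - b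
gives F(a)(b) = 0 for every global section, while P contains the square of a linear form that
vanishes at a and not at b (`not_isGloballyGenerated_dual_twist`). -/

noncomputable section

namespace Drezet

open MvPolynomial

/-! ### Homogeneous components and divisibility of polynomials. -/

section Algebra

variable {σ : Type*} {R : Type*} [CommRing R]

/-- Used to cut polynomial identities down to a single degree, so that coefficients produced by
ideal membership or divisibility can be taken homogeneous. -/
theorem homogeneousComponent_mul {e : ℕ} {f : MvPolynomial σ R} (hf : f.IsHomogeneous e)
    (g : MvPolynomial σ R) (k : ℕ) : homogeneousComponent k (f * g) =
      if e ≤ k then f * homogeneousComponent (k - e) g else 0 := by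
  classical
  let _ := MvPolynomial.gradedAlgebra (σ := σ) (R := R)
  have hdec : ∀ (φ : MvPolynomial σ R) (i : ℕ),
      (DirectSum.decompose (homogeneousSubmodule σ R) φ i : MvPolynomial σ R) =
        homogeneousComponent i φ := decomposition.decompose'_apply
  rw [← hdec, ← hdec]
  exact DirectSum.coe_decompose_mul_of_left_mem (homogeneousSubmodule σ R) k
    ((mem_homogeneousSubmodule _ _).2 hf)

theorem homogeneousComponent_mul_add {e : ℕ} {f : MvPolynomial σ R} (hf : f.IsHomogeneous e)
    (g : MvPolynomial σ R) (k : ℕ) :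
    homogeneousComponent (e + k) (f * g) = f * homogeneousComponent k g := by
  simp [homogeneousComponent_mul hf]

theorem X_pow_dvd_of_mul_eq [IsDomain R] {i j : σ} (hij : i ≠ j) {k : ℕ}
    {u w : MvPolynomial σ R} (h : X i ^ k * u = X j ^ k * w) : X j ^ k ∣ u := by
  refine (X_prime (R := R) (i := j)).pow_dvd_of_dvd_mul_left k (fun hd => ?_) ⟨w, h⟩
  exact hij (X_dvd_X.1 ((X_prime (R := R)).dvd_of_dvd_pow hd)).symm

/-- If `f` divides both `X i ^ k * g` and `X j ^ k * g`, it divides `g`. -/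
theorem dvd_of_dvd_X_pow_mul [IsDomain R] {i j : σ} (hij : i ≠ j) {k : ℕ}
    {f g : MvPolynomial σ R} (hf : f ≠ 0) (hi : f ∣ X i ^ k * g) (hj : f ∣ X j ^ k * g) :
    f ∣ g := by
  obtain ⟨u, hu⟩ := hi
  obtain ⟨w, hw⟩ := hj
  have h1 : X i ^ k * w = X j ^ k * u := mul_left_cancel₀ hf (by
    linear_combination (-X i ^ k) * hw + X j ^ k * hu)
  obtain ⟨u', rfl⟩ := X_pow_dvd_of_mul_eq hij.symm h1.symm
  refine ⟨u', mul_left_cancel₀ (pow_ne_zero k (X_ne_zero i)) ?_⟩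
  rw [hu]
  ring

theorem mem_span_X_pow_pair {i j : σ} {k : ℕ} {c : MvPolynomial σ R} :
    c ∈ Ideal.span {X i ^ k, X j ^ k} ↔ ∀ m ∈ c.support, k ≤ m i ∨ k ≤ m j := by
  have := mem_ideal_span_monomial_image (x := c) (s := {Finsupp.single i k, Finsupp.single j k})
  rw [Set.image_pair] at this
  simpa [X_pow_eq_monomial] using this

/-- Membership in this monomial ideal depends only on the exponents of `X i` and `X j`, which
multiplication by `X l` leaves alone. -/
theorem mem_span_X_pow_pair_of_X_pow_mul_mem {i j l : σ} (hi : l ≠ i) (hj : l ≠ j) {k r : ℕ}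
    {c : MvPolynomial σ R} (h : X l ^ r * c ∈ Ideal.span {X i ^ k, X j ^ k}) :
    c ∈ Ideal.span {X i ^ k, X j ^ k} := by
  rw [mem_span_X_pow_pair] at h ⊢
  intro m hm
  have := h (Finsupp.single l r + m) (by
    rw [MvPolynomial.mem_support_iff, X_pow_eq_monomial, coeff_monomial_mul, one_mul]
    exact MvPolynomial.mem_support_iff.1 hm)
  simpa [Finsupp.single_eq_of_ne hi.symm, Finsupp.single_eq_of_ne hj.symm] using this

end Algebra

variable {n : ℕ}

/-! ### The Nullstellensatz, and the vanishing of H¹(𝒪(d)) in polynomial form. -/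

theorem exists_ne_zero_of_ne_zero {v : Fin (n + 1) → ℂ} (hv : v ≠ 0) : ∃ i, v i ≠ 0 := by
  by_contra! h
  exact hv (funext h)

theorem exists_pow_mem_span {s : Set (MvPolynomial (Fin (n + 1)) ℂ)}
    {g : MvPolynomial (Fin (n + 1)) ℂ}
    (h : ∀ v, (∀ f ∈ s, val f v = 0) → val g v = 0) : ∃ k, g ^ k ∈ Ideal.span s := by
  have : g ∈ (Ideal.span s).radical := by
    rw [← vanishingIdeal_zeroLocus_eq_radical (K := ℂ), mem_vanishingIdeal_iff]
    intro v hv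
    have := h v fun f hf => by simpa [val, aeval_eq_eval] using hv f (Ideal.subset_span hf)
    simpa [val, aeval_eq_eval] using this
  exact this

/-- The factor `X 0` supplies the vanishing at the origin, where nothing is assumed about `g`. -/
theorem eq_zero_of_val_eq_zero {g : MvPolynomial (Fin (n + 1)) ℂ}
    (h : ∀ v, v ≠ 0 → val g v = 0) : g = 0 := by
  have : X 0 * g = 0 := MvPolynomial.funext fun v => by
    by_cases hv : v = 0
    · simp [hv]
    · have := h v hv
      simp only [val] at this
      simp [this]
  exact (mul_eq_zero.1 this).resolve_left (X_ne_zero _)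

/-- A family of homogeneous polynomials without common zeros on `ℙⁿ` generates a power of every
variable, with homogeneous coefficients. -/
theorem exists_X_pow_eq_sum {A : Type*} [Fintype A] {f : A → MvPolynomial (Fin (n + 1)) ℂ}
    {e : A → ℕ} (hf : ∀ α, (f α).IsHomogeneous (e α)) (hcov : ∀ v, v ≠ 0 → ∃ α, val (f α) v ≠ 0) :
    ∃ k : ℕ, (∀ α, e α ≤ k) ∧ ∀ l, ∃ c : A → MvPolynomial (Fin (n + 1)) ℂ,
      (∀ α, (c α).IsHomogeneous (k - e α)) ∧ ∑ α, f α * c α = X l ^ k := by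
  have h1 : ∀ l, ∃ k, (X l : MvPolynomial (Fin (n + 1)) ℂ) ^ k ∈ Ideal.span (Set.range f) :=
    fun l => exists_pow_mem_span fun v hv => by
      by_cases h0 : v = 0
      · simp [h0]
      · obtain ⟨α, hα⟩ := hcov v h0
        exact absurd (hv _ ⟨α, rfl⟩) hα
  choose k hk using h1
  refine ⟨∑ l, k l + ∑ α, e α, fun α => (Finset.single_le_sum (f := e) (fun _ _ => Nat.zero_le _)
    (Finset.mem_univ α)).trans (Nat.le_add_left _ _), fun l => ?_⟩
  set K := ∑ l, k l + ∑ α, e α with hK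
  have hle : k l ≤ K := (Finset.single_le_sum (f := k) (fun _ _ => Nat.zero_le _)
    (Finset.mem_univ l)).trans (Nat.le_add_right _ _)
  have hmem : (X l : MvPolynomial (Fin (n + 1)) ℂ) ^ K ∈ Ideal.span (Set.range f) := by
    rw [← Nat.sub_add_cancel hle, pow_add]
    exact Ideal.mul_mem_left _ _ (hk l)
  obtain ⟨c, hc⟩ := Ideal.mem_span_range_iff_exists_fun.1 hmem
  refine ⟨fun α => homogeneousComponent (K - e α) (c α), fun α =>
    homogeneousComponent_isHomogeneous _ _, ?_⟩
  have := congrArg (homogeneousComponent K) hc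
  rw [homogeneousComponent_eq_self (isHomogeneous_X_pow _ _), map_sum] at this
  rw [← this]
  refine Finset.sum_congr rfl fun α _ => ?_
  rw [mul_comm (c α), homogeneousComponent_mul (hf α), if_pos]
  exact (Finset.single_le_sum (f := e) (fun _ _ => Nat.zero_le _)
    (Finset.mem_univ α)).trans (Nat.le_add_left _ _)

/-- Pigeonhole: with two variables only, a monomial of degree at least 2k has an exponent at least
k. -/
theorem mem_span_X_pow_of_isHomogeneous {i j : Fin (n + 1)} (hij : i ≠ j)
    (hall : ∀ l, l = i ∨ l = j) {k d : ℕ} {c : MvPolynomial (Fin (n + 1)) ℂ}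
    (hc : c.IsHomogeneous (2 * k + d)) : c ∈ Ideal.span {X i ^ k, X j ^ k} := by
  rw [mem_span_X_pow_pair]
  intro m hm
  have hdeg : ∑ l, m l = 2 * k + d := by
    have := hc (MvPolynomial.mem_support_iff.1 hm)
    rw [Pi.one_def, ← Finsupp.degree_eq_weight_one, Finsupp.degree_apply] at this
    rw [← this]
    exact (Finset.sum_subset (Finset.subset_univ _) (by simp)).symm
  have huniv : (Finset.univ : Finset (Fin (n + 1))) = {i, j} := by
    ext l
    simpa using hall l
  rw [huniv, Finset.sum_pair hij] at hdeg
  omega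

/-- The vanishing of `H¹(ℙⁿ, 𝒪(d))`, `n ≥ 1` and `d ≥ 0`, in terms of polynomials: the cocycle is
`a α β / (f α * f β)` on the intersection of `D(f α)` and `D(f β)`. -/
theorem exists_eq_sub_of_cocycle {A : Type*} [Fintype A] (hn : 1 ≤ n)
    {f : A → MvPolynomial (Fin (n + 1)) ℂ} {e : A → ℕ} {d : ℕ}
    (hf : ∀ α, (f α).IsHomogeneous (e α)) (hf0 : ∀ α, f α ≠ 0)
    (hcov : ∀ v, v ≠ 0 → ∃ α, val (f α) v ≠ 0)
    {a : A → A → MvPolynomial (Fin (n + 1)) ℂ} (ha : ∀ α β, (a α β).IsHomogeneous (e α + e β + d))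
    (hcoc : ∀ α β γ, f γ * a α β + f α * a β γ = f β * a α γ) :
    ∃ H : A → MvPolynomial (Fin (n + 1)) ℂ, (∀ β, (H β).IsHomogeneous (e β + d)) ∧
      ∀ α β, a α β = f α * H β - f β * H α := by
  obtain ⟨k, hek, hk⟩ := exists_X_pow_eq_sum hf hcov
  choose c hc hcX using hk
  let i : Fin (n + 1) := 0
  let j : Fin (n + 1) := ⟨1, by omega⟩
  have hij : i ≠ j := by simp [i, j, Fin.ext_iff]
  -- Contracting the cocycle with the relation ∑ f γ * c l γ = X l ^ k, a partition of unity up to X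
  -- l ^ k: the quotients B l β / f β split X l ^ k times the cocycle.
  let B : Fin (n + 1) → A → MvPolynomial (Fin (n + 1)) ℂ := fun l β => ∑ γ, c l γ * a γ β
  have hBhom : ∀ l β, (B l β).IsHomogeneous (k + (e β + d)) := fun l β =>
    IsHomogeneous.sum _ _ _ fun γ _ => by
      have := (hc l γ).mul (ha γ β)
      rwa [show k - e γ + (e γ + e β + d) = k + (e β + d) by have := hek γ; omega] at this
  have hB : ∀ l α β, f α * B l β - f β * B l α = X l ^ k * a α β := fun l α β => by
    rw [← hcX l, Finset.sum_mul, Finset.mul_sum, Finset.mul_sum, ← Finset.sum_sub_distrib]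
    refine Finset.sum_congr rfl fun γ _ => ?_
    linear_combination (-c l γ) * hcoc γ α β
  obtain ⟨α₀, -⟩ : ∃ α : A, True := by
    obtain ⟨α, -⟩ := hcov (Pi.single 0 1) (by simp)
    exact ⟨α, trivial⟩
  -- Up to the factor X i ^ k * X j ^ k, D β / f β is the difference of the splittings with
  -- denominators X i ^ k and X j ^ k. It does not depend on β, and it is a polynomial C of degree
  -- 2k + d.
  let D : A → MvPolynomial (Fin (n + 1)) ℂ := fun β => X j ^ k * B i β - X i ^ k * B j β
  have hD : ∀ α β, f α * D β = f β * D α := fun α β => by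
    simp only [D]
    linear_combination X j ^ k * hB i α β - X i ^ k * hB j α β
  have hdvd : ∀ β, f β ∣ D β := fun β => by
    have h1 : ∀ l, f β ∣ X l ^ k * D β := fun l => by
      rw [← hcX l, Finset.sum_mul]
      refine Finset.dvd_sum fun γ _ => ⟨c l γ * D γ, ?_⟩
      linear_combination c l γ * hD γ β
    exact dvd_of_dvd_X_pow_mul hij (hf0 β) (h1 i) (h1 j)
  obtain ⟨c₀, hc₀⟩ := hdvd α₀
  let C := homogeneousComponent (2 * k + d) c₀
  have hDhom : (D α₀).IsHomogeneous (e α₀ + (2 * k + d)) := by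
    have h1 := (isHomogeneous_X_pow (R := ℂ) j k).mul (hBhom i α₀)
    have h2 := (isHomogeneous_X_pow (R := ℂ) i k).mul (hBhom j α₀)
    have := h1.sub h2
    rwa [show k + (k + (e α₀ + d)) = e α₀ + (2 * k + d) by ring] at this
  have hC₀ : D α₀ = f α₀ * C := by
    rw [← homogeneousComponent_eq_self hDhom, hc₀, homogeneousComponent_mul_add (hf α₀)]
  have hC : ∀ β, D β = f β * C := fun β => mul_left_cancel₀ (hf0 α₀) (by
    rw [hD α₀ β, hC₀]
    ring)
  -- This is the obstruction to a splitting without powers of variables in the denominators. With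
  -- two variables the degree kills it. A third variable `l` gives X l ^ k * C = ∑ c l γ * D γ,
  -- which lies in the ideal, and X l is regular modulo the ideal.
  have hmem : C ∈ Ideal.span {X i ^ k, X j ^ k} := by
    by_cases hall : ∀ l, l = i ∨ l = j
    · exact mem_span_X_pow_of_isHomogeneous hij hall (homogeneousComponent_isHomogeneous _ _)
    · push Not at hall
      obtain ⟨l, hli, hlj⟩ := hall
      refine mem_span_X_pow_pair_of_X_pow_mul_mem (r := k) hli hlj ?_
      rw [← hcX l, Finset.sum_mul]
      refine Ideal.sum_mem _ fun γ _ => ?_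
      rw [mul_right_comm, ← hC γ]
      refine Ideal.mul_mem_right _ _ (Ideal.sub_mem _ ?_ ?_)
      · exact Ideal.mul_mem_right _ _ (Ideal.subset_span (by simp))
      · exact Ideal.mul_mem_right _ _ (Ideal.subset_span (by simp))
  obtain ⟨r, s, hrs⟩ := Ideal.mem_span_pair.1 hmem
  -- Substituting C = r X_i^k + s X_j^k in D β = f β * C gives X_j^k (B i β - f β s) = X_i^k (B j β
  -- + f β r). Subtracting f β * s from B i β does not change the coboundary.
  have hH : ∀ β, X i ^ k ∣ B i β - f β * s := fun β => by
    refine X_pow_dvd_of_mul_eq (i := j) hij.symm (w := B j β + f β * r) ?_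
    have := hC β
    simp only [D] at this
    linear_combination this - f β * hrs
  choose H hH using hH
  have hXi : (X i : MvPolynomial (Fin (n + 1)) ℂ) ^ k ≠ 0 := pow_ne_zero k (X_ne_zero i)
  have hfH : ∀ α β, a α β = f α * H β - f β * H α := fun α β => mul_left_cancel₀ hXi (by
    rw [← hB i α β]
    linear_combination f α * hH β - f β * hH α)
  refine ⟨fun β => homogeneousComponent (e β + d) (H β), fun β =>
    homogeneousComponent_isHomogeneous _ _, fun α β => ?_⟩
  conv_lhs => rw [← homogeneousComponent_eq_self (ha α β), hfH α β, map_sub]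
  rw [show e α + e β + d = e α + (e β + d) by ring, homogeneousComponent_mul_add (hf α),
    show e α + (e β + d) = e β + (e α + d) by ring, homogeneousComponent_mul_add (hf β)]

/-! ### Sections of 𝒪(d) as homogeneous functions on open cones. -/

/-- Open cones in `ℂⁿ⁺¹ ∖ 0`, that is, preimages of open subsets of `ℙⁿ`. -/
def IsOpenCone (C : Set (Fin (n + 1) → ℂ)) : Prop :=
  ∀ v ∈ C, ∃ (q : ℕ) (b : MvPolynomial (Fin (n + 1)) ℂ), b.IsHomogeneous q ∧ val b v ≠ 0 ∧
    ∀ w, w ≠ 0 → val b w ≠ 0 → w ∈ C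

/-- Sections of `𝒪(d)` over an open cone `C`: locally quotients of homogeneous polynomials whose
degrees differ by `d`. -/
def IsHomReg (d : ℕ) (C : Set (Fin (n + 1) → ℂ)) (F : (Fin (n + 1) → ℂ) → ℂ) : Prop :=
  ∀ v ∈ C, ∃ (q : ℕ) (a b : MvPolynomial (Fin (n + 1)) ℂ), a.IsHomogeneous (q + d) ∧
    b.IsHomogeneous q ∧ val b v ≠ 0 ∧ ∀ w, w ≠ 0 → val b w ≠ 0 → w ∈ C ∧ F w = val a w / val b w

theorem IsOpenCone.inter {C C' : Set (Fin (n + 1) → ℂ)} (hC : IsOpenCone C) (hC' : IsOpenCone C') :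
    IsOpenCone (C ∩ C') := by
  rintro v ⟨hv, hv'⟩
  obtain ⟨q, b, hb, hbv, H⟩ := hC v hv
  obtain ⟨q', b', hb', hbv', H'⟩ := hC' v hv'
  refine ⟨q + q', b * b', hb.mul hb', by simpa [val] using ⟨hbv, hbv'⟩, fun w hw hbw => ?_⟩
  simp only [val, map_mul, mul_ne_zero_iff] at hbw
  exact ⟨H w hw hbw.1, H' w hw hbw.2⟩

theorem isOpenCone_basic {e : ℕ} {f : MvPolynomial (Fin (n + 1)) ℂ} (hf : f.IsHomogeneous e) :
    IsOpenCone {w | w ≠ 0 ∧ val f w ≠ 0} :=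
  fun _ hv => ⟨e, f, hf, hv.2, fun _ hw hfw => ⟨hw, hfw⟩⟩

namespace IsHomReg

variable {d d' : ℕ} {C C' : Set (Fin (n + 1) → ℂ)} {F G : (Fin (n + 1) → ℂ) → ℂ}

theorem of_local (h : ∀ v ∈ C, ∃ C' ⊆ C, v ∈ C' ∧ IsHomReg d C' F) : IsHomReg d C F := by
  intro v hv
  obtain ⟨C', hC', hv', H⟩ := h v hv
  obtain ⟨q, a, b, ha, hb, hbv, K⟩ := H v hv'
  exact ⟨q, a, b, ha, hb, hbv, fun w hw hbw => ⟨hC' (K w hw hbw).1, (K w hw hbw).2⟩⟩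

theorem congr (h : IsHomReg d C F) (hFG : ∀ v ∈ C, F v = G v) : IsHomReg d C G := by
  intro v hv
  obtain ⟨q, a, b, ha, hb, hbv, K⟩ := h v hv
  exact ⟨q, a, b, ha, hb, hbv, fun w hw hbw =>
    ⟨(K w hw hbw).1, (hFG w (K w hw hbw).1).symm.trans (K w hw hbw).2⟩⟩

theorem mono (h : IsHomReg d C F) (hC' : IsOpenCone C') (hsub : C' ⊆ C) : IsHomReg d C' F := by
  intro v hv
  obtain ⟨q, a, b, ha, hb, hbv, K⟩ := h v (hsub hv)
  obtain ⟨q', b', hb', hbv', H'⟩ := hC' v hv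
  refine ⟨q + q', a * b', b * b', ?_, hb.mul hb', by simpa [val] using ⟨hbv, hbv'⟩,
    fun w hw hbw => ?_⟩
  · rw [add_right_comm]
    exact ha.mul hb'
  · simp only [val, map_mul, mul_ne_zero_iff] at hbw ⊢
    refine ⟨H' w hw hbw.2, ?_⟩
    rw [mul_div_mul_right _ _ hbw.2]
    exact (K w hw hbw.1).2

theorem div {q : ℕ} {a b : MvPolynomial (Fin (n + 1)) ℂ} (ha : a.IsHomogeneous (q + d))
    (hb : b.IsHomogeneous q) (hC : IsOpenCone C) (h : ∀ v ∈ C, val b v ≠ 0) :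
    IsHomReg d C (fun v => val a v / val b v) := by
  intro v hv
  obtain ⟨q', b', hb', hbv', H'⟩ := hC v hv
  refine ⟨q + q', a * b', b * b', ?_, hb.mul hb', by simpa [val] using ⟨h v hv, hbv'⟩,
    fun w hw hbw => ?_⟩
  · rw [add_right_comm]
    exact ha.mul hb'
  · simp only [val, map_mul, mul_ne_zero_iff] at hbw ⊢
    exact ⟨H' w hw hbw.2, (mul_div_mul_right _ _ hbw.2).symm⟩

theorem poly {a : MvPolynomial (Fin (n + 1)) ℂ} (ha : a.IsHomogeneous d) (hC : IsOpenCone C) :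
    IsHomReg d C (val a) := by
  have := div (d := d) (q := 0) (by rwa [zero_add]) (isHomogeneous_one (Fin (n + 1)) ℂ) hC
    (fun v _ => by simp [val])
  simpa [val] using this

theorem mul (hF : IsHomReg d C F) (hG : IsHomReg d' C G) :
    IsHomReg (d + d') C (fun v => F v * G v) := by
  intro v hv
  obtain ⟨q, a, b, ha, hb, hbv, K⟩ := hF v hv
  obtain ⟨q', a', b', ha', hb', hbv', K'⟩ := hG v hv
  refine ⟨q + q', a * a', b * b', ?_, hb.mul hb', by simpa [val] using ⟨hbv, hbv'⟩,
    fun w hw hbw => ?_⟩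
  · rw [add_add_add_comm]
    exact ha.mul ha'
  · simp only [val, map_mul, mul_ne_zero_iff] at hbw ⊢
    refine ⟨(K w hw hbw.1).1, ?_⟩
    rw [(K w hw hbw.1).2, (K' w hw hbw.2).2, div_mul_div_comm]

theorem add (hF : IsHomReg d C F) (hG : IsHomReg d C G) :
    IsHomReg d C (fun v => F v + G v) := by
  intro v hv
  obtain ⟨q, a, b, ha, hb, hbv, K⟩ := hF v hv
  obtain ⟨q', a', b', ha', hb', hbv', K'⟩ := hG v hv
  refine ⟨q + q', a * b' + b * a', b * b', ?_, hb.mul hb', by simpa [val] using ⟨hbv, hbv'⟩,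
    fun w hw hbw => ?_⟩
  · refine IsHomogeneous.add ?_ ?_
    · rw [add_right_comm]
      exact ha.mul hb'
    · rw [add_assoc]
      exact hb.mul ha'
  · simp only [val, map_mul, map_add, mul_ne_zero_iff] at hbw ⊢
    refine ⟨(K w hw hbw.1).1, ?_⟩
    rw [(K w hw hbw.1).2, (K' w hw hbw.2).2, div_add_div _ _ hbw.1 hbw.2]

theorem zero (hC : IsOpenCone C) : IsHomReg d C (fun _ => 0) :=
  (poly (isHomogeneous_zero (Fin (n + 1)) ℂ d) hC).congr fun v _ => by simp [val]

theorem const_mul (c : ℂ) (hC : IsOpenCone C) (hF : IsHomReg d C F) :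
    IsHomReg d C (fun v => c * F v) := by
  have := (poly (isHomogeneous_C (Fin (n + 1)) c) hC).mul hF
  simpa [val] using this

theorem sub (hC : IsOpenCone C) (hF : IsHomReg d C F) (hG : IsHomReg d C G) :
    IsHomReg d C (fun v => F v - G v) := by
  have := hF.add (hG.const_mul (-1) hC)
  simpa [sub_eq_add_neg] using this

theorem sum {κ : Type*} (s : Finset κ) {F : κ → (Fin (n + 1) → ℂ) → ℂ} (hC : IsOpenCone C)
    (hF : ∀ i ∈ s, IsHomReg d C (F i)) : IsHomReg d C (fun v => ∑ i ∈ s, F i v) := by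
  classical
  induction s using Finset.induction_on with
  | empty => simpa using zero hC
  | insert i s hi ih =>
    simp only [Finset.sum_insert hi]
    exact (hF i (by simp)).add (ih fun j hj => hF j (by simp [hj]))

/-- Sections of `𝒪(d)` over `D(f)` are of the form `A / f ^ N`. -/
theorem exists_eq_div_pow {e : ℕ} {f : MvPolynomial (Fin (n + 1)) ℂ} (hf : f.IsHomogeneous e)
    (he : 0 < e) (hF : IsHomReg d {w | w ≠ 0 ∧ val f w ≠ 0} F) :
    ∃ (N : ℕ) (A : MvPolynomial (Fin (n + 1)) ℂ), A.IsHomogeneous (e * N + d) ∧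
      ∀ w, w ≠ 0 → val f w ≠ 0 → F w = val A w / val f w ^ N := by
  let good : MvPolynomial (Fin (n + 1)) ℂ → MvPolynomial (Fin (n + 1)) ℂ → Prop := fun a b =>
    b ≠ 0 ∧ ∀ w, w ≠ 0 → val b w ≠ 0 → F w = val a w / val b w
  have hgood : ∀ a b a' b', good a b → good a' b' → b * a' = b' * a := by
    rintro a b a' b' ⟨hb, h⟩ ⟨hb', h'⟩
    have : b * b' * (b * a' - b' * a) = 0 := eq_zero_of_val_eq_zero fun v hv => by
      by_cases h1 : val b v = 0
      · simp only [val] at h1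
        simp [h1]
      by_cases h2 : val b' v = 0
      · simp only [val] at h2
        simp [h2]
      have h3 := (h v hv h1).symm.trans (h' v hv h2)
      rw [div_eq_div_iff h1 h2] at h3
      simp only [val] at h3
      simp only [val, map_mul, map_sub]
      linear_combination (-(eval v b * eval v b')) * h3
    exact sub_eq_zero.1 ((mul_eq_zero.1 this).resolve_left (mul_ne_zero hb hb'))
  -- The ideal of denominators: the g for which g * F is a polynomial A, in the sense that A / g
  -- equals every local expression a / b after cross-multiplication. It contains every local
  -- denominator. These have no common zero on D(f), so a power of f lies in it.
  let J : Ideal (MvPolynomial (Fin (n + 1)) ℂ) :=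
    { carrier := {g | ∃ A, ∀ a b, good a b → b * A = g * a}
      zero_mem' := ⟨0, fun a b _ => by simp⟩
      add_mem' := by
        rintro g g' ⟨A, hA⟩ ⟨A', hA'⟩
        exact ⟨A + A', fun a b h => by rw [mul_add, hA a b h, hA' a b h, add_mul]⟩
      smul_mem' := by
        rintro c g ⟨A, hA⟩
        exact ⟨c * A, fun a b h => by
          rw [smul_eq_mul, mul_left_comm, hA a b h, mul_assoc]⟩ }
  have hloc : ∀ v, v ≠ 0 → val f v ≠ 0 → ∃ q a b, a.IsHomogeneous (q + d) ∧ b.IsHomogeneous q ∧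
      val b v ≠ 0 ∧ good a b := fun v hv hfv => by
    obtain ⟨q, a, b, ha, hb, hbv, K⟩ := hF v ⟨hv, hfv⟩
    exact ⟨q, a, b, ha, hb, hbv, by rintro rfl; simp [val] at hbv,
      fun w hw hbw => (K w hw hbw).2⟩
  obtain ⟨N, hN⟩ := exists_pow_mem_span (s := {b | ∃ a, good a b}) (g := f) fun v hv => by
    by_contra hfv
    -- Positive degree makes f vanish at the origin, which D(f) must avoid.
    have hv0 : v ≠ 0 := by
      rintro rfl
      have := val_smul hf 0 0
      rw [zero_smul, zero_pow he.ne', zero_mul] at this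
      exact hfv this
    obtain ⟨q, a, b, -, -, hbv, hab⟩ := hloc v hv0 hfv
    exact hbv (hv b ⟨a, hab⟩)
  have hle : Ideal.span {b | ∃ a, good a b} ≤ J := by
    rw [Ideal.span_le]
    rintro b ⟨a, hab⟩
    exact ⟨a, fun a' b' h' => (hgood a b a' b' hab h').symm⟩
  obtain ⟨A, hA⟩ := hle hN
  refine ⟨N, homogeneousComponent (e * N + d) A, homogeneousComponent_isHomogeneous _ _,
    fun w hw hfw => ?_⟩
  obtain ⟨q, a, b, ha, hb, hbw, hab⟩ := hloc w hw hfw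
  have h1 : b * homogeneousComponent (e * N + d) A = f ^ N * a := by
    rw [← homogeneousComponent_mul_add hb, hA a b hab]
    refine homogeneousComponent_eq_self ?_
    have := (hf.pow N).mul ha
    rwa [show e * N + (q + d) = q + (e * N + d) by ring] at this
  have h2 := congrArg (eval w) h1
  rw [hab.2 w hw hbw, div_eq_div_iff hbw (pow_ne_zero N hfw)]
  simp only [map_mul, map_pow] at h2
  simp only [val]
  linear_combination (-1 : ℂ) * h2

/-- Global sections of `𝒪(d)` are homogeneous polynomials of degree `d`. -/
theorem exists_eq_val (hn : 1 ≤ n) (hF : IsHomReg d {w | w ≠ 0} F) :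
    ∃ A : MvPolynomial (Fin (n + 1)) ℂ, A.IsHomogeneous d ∧ ∀ w, w ≠ 0 → F w = val A w := by
  have hX : ∀ l : Fin (n + 1), ∃ (N : ℕ) (A : MvPolynomial (Fin (n + 1)) ℂ),
      A.IsHomogeneous (1 * N + d) ∧ ∀ w, w ≠ 0 → val (X l) w ≠ 0 →
        F w = val A w / val (X l) w ^ N := fun l =>
    exists_eq_div_pow (isHomogeneous_X ℂ l) one_pos
      (hF.mono (isOpenCone_basic (isHomogeneous_X ℂ l)) fun w hw => hw.1)
  choose N A hA hFA using hX
  have hmul : ∀ l w, w ≠ 0 → w l ≠ 0 → w l ^ N l * F w = val (A l) w := fun l w hw hl => by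
    rw [hFA l w hw (by simpa [val] using hl)]
    simp only [val, eval_X]
    field_simp
  have hrel : ∀ i j, X i ^ N i * A j = X j ^ N j * A i := fun i j => by
    have : X i * X j * (X i ^ N i * A j - X j ^ N j * A i) = 0 :=
      eq_zero_of_val_eq_zero fun v hv => by
        by_cases h1 : v i = 0
        · simp [val, h1]
        by_cases h2 : v j = 0
        · simp [val, h2]
        have h3 := hmul i v hv h1
        have h4 := hmul j v hv h2
        simp only [val] at h3 h4
        simp only [val, map_mul, map_sub, map_pow, eval_X, ← h3, ← h4]
        ring
    exact sub_eq_zero.1 ((mul_eq_zero.1 this).resolve_left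
      (mul_ne_zero (X_ne_zero i) (X_ne_zero j)))
  let i : Fin (n + 1) := 0
  let j : Fin (n + 1) := ⟨1, by omega⟩
  have hij : i ≠ j := by simp [i, j, Fin.ext_iff]
  -- Comparing the expressions on D(X i) and D(X j) for two distinct variables shows that the
  -- denominator cancels; this is where n ≥ 1 enters.
  obtain ⟨B, hB⟩ : X i ^ N i ∣ A i := by
    refine (X_prime (R := ℂ) (i := i)).pow_dvd_of_dvd_mul_left _ (fun hd => ?_)
      ⟨A j, (hrel i j).symm⟩
    exact hij (X_dvd_X.1 ((X_prime (R := ℂ)).dvd_of_dvd_pow hd))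
  refine ⟨homogeneousComponent d B, homogeneousComponent_isHomogeneous _ _, fun w hw => ?_⟩
  have hi : A i = X i ^ N i * homogeneousComponent d B := by
    have h1 := homogeneousComponent_mul_add (isHomogeneous_X_pow (R := ℂ) i (N i)) B d
    rw [← hB] at h1
    rw [← h1]
    have h2 := hA i
    rw [one_mul] at h2
    exact (homogeneousComponent_eq_self h2).symm
  have hl : ∀ l, A l = X l ^ N l * homogeneousComponent d B := fun l =>
    mul_left_cancel₀ (pow_ne_zero (N i) (X_ne_zero i)) (by rw [hrel i l, hi]; ring)
  obtain ⟨l, hwl⟩ := exists_ne_zero_of_ne_zero hw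
  have h1 := hmul l w hw hwl
  rw [hl l] at h1
  simp only [val, map_mul, map_pow, eval_X] at h1
  exact mul_left_cancel₀ (pow_ne_zero _ hwl) h1

end IsHomReg

/-! ### Čech vanishing for 𝒪(d) on arbitrary open covers. -/

/-- A cover of `ℂⁿ⁺¹ ∖ 0` by open cones has a finite refinement by basic open cones. -/
theorem exists_finite_refinement {ι : Type*} {C : ι → Set (Fin (n + 1) → ℂ)}
    (hC : ∀ i, IsOpenCone (C i)) (hcov : ∀ v, v ≠ 0 → ∃ i, v ∈ C i) :
    ∃ (s : Finset (MvPolynomial (Fin (n + 1)) ℂ)),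
      (∀ f ∈ s, f ≠ 0 ∧ ∃ e, 0 < e ∧ f.IsHomogeneous e ∧
        ∃ i, ∀ w, w ≠ 0 → val f w ≠ 0 → w ∈ C i) ∧
      ∀ v, v ≠ 0 → ∃ f ∈ s, val f v ≠ 0 := by
  let B : Set (MvPolynomial (Fin (n + 1)) ℂ) := {f | f ≠ 0 ∧ ∃ e, 0 < e ∧ f.IsHomogeneous e ∧
    ∃ i, ∀ w, w ≠ 0 → val f w ≠ 0 → w ∈ C i}
  -- Quasi-compactness from Noetherianity: a common zero of the finitely many generators is a zero
  -- of all of `B`.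
  obtain ⟨s, hsB, hs⟩ := (Submodule.fg_span_iff_fg_span_finset_subset B).1
    (IsNoetherian.noetherian (Ideal.span B))
  refine ⟨s, fun f hf => hsB hf, fun v hv => ?_⟩
  by_contra! hcon
  obtain ⟨i, hi⟩ := hcov v hv
  obtain ⟨q, b, hb, hbv, H⟩ := hC i v hi
  obtain ⟨l, hl⟩ := exists_ne_zero_of_ne_zero hv
  have hbX : val (b * X l) v ≠ 0 := by simpa [val] using ⟨hbv, hl⟩
  -- The factor `X l` makes the degree positive, since `b` may be a constant.
  have hmem : b * X l ∈ B := by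
    refine ⟨?_, q + 1, by omega, hb.mul (isHomogeneous_X ℂ l), i, fun w hw hbw => H w hw ?_⟩
    · intro h0
      rw [h0] at hbX
      simp [val] at hbX
    · simp only [val, map_mul, mul_ne_zero_iff] at hbw
      exact hbw.1
  have hle : Ideal.span (s : Set (MvPolynomial (Fin (n + 1)) ℂ)) ≤ RingHom.ker (eval v) := by
    rw [Ideal.span_le]
    exact fun f hf => hcon f hf
  refine hbX (hle ?_)
  have : b * X l ∈ Submodule.span (MvPolynomial (Fin (n + 1)) ℂ) B := Submodule.subset_span hmem
  rw [hs] at this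
  exact this

/-- `H¹(ℙⁿ, 𝒪(d)) = 0` for `n ≥ 1` and `d ≥ 0`. -/
theorem exists_isHomReg_eq_sub {ι : Type*} {d : ℕ} (hn : 1 ≤ n) {C : ι → Set (Fin (n + 1) → ℂ)}
    (hC : ∀ i, IsOpenCone (C i)) (hC0 : ∀ i, ∀ v ∈ C i, v ≠ 0) (hcov : ∀ v, v ≠ 0 → ∃ i, v ∈ C i)
    {G : ι → ι → (Fin (n + 1) → ℂ) → ℂ} (hG : ∀ i j, IsHomReg d (C i ∩ C j) (G i j))
    (hcoc : ∀ i j k, ∀ v ∈ C i, v ∈ C j → v ∈ C k → G i j v + G j k v = G i k v) :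
    ∃ B : ι → (Fin (n + 1) → ℂ) → ℂ, (∀ i, IsHomReg d (C i) (B i)) ∧
      ∀ i j, ∀ v ∈ C i, v ∈ C j → G i j v = B j v - B i v := by
  classical
  obtain ⟨s, hs, hscov⟩ := exists_finite_refinement hC hcov
  have hs' : ∀ f : s, f.1 ≠ 0 ∧ ∃ e, 0 < e ∧ f.1.IsHomogeneous e ∧
        ∃ i, ∀ w, w ≠ 0 → val f.1 w ≠ 0 → w ∈ C i := fun f => hs f.1 f.2
  choose hf0 e he hfe τ hτ using hs'
  have hden : ∀ f g : s, ∃ (N : ℕ) (A : MvPolynomial (Fin (n + 1)) ℂ),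
      A.IsHomogeneous ((e f + e g) * N + d) ∧ ∀ w, w ≠ 0 → val (f.1 * g.1) w ≠ 0 →
        G (τ f) (τ g) w = val A w / val (f.1 * g.1) w ^ N := fun f g =>
    IsHomReg.exists_eq_div_pow ((hfe f).mul (hfe g)) (by have := he f; omega)
      ((hG (τ f) (τ g)).mono (isOpenCone_basic ((hfe f).mul (hfe g))) fun w hw => by
        have h2 := hw.2
        simp only [val, map_mul, mul_ne_zero_iff] at h2
        exact ⟨hτ f w hw.1 h2.1, hτ g w hw.1 h2.2⟩)
  choose N A hA hGA using hden
  -- A common exponent, so that the cocycle becomes `a f g` over f ^ M * g ^ M, as the polynomial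
  -- lemma requires.
  let M : ℕ := ∑ f, ∑ g, N f g
  have hNM : ∀ f g, N f g ≤ M := fun f g =>
    (Finset.single_le_sum (f := fun g => N f g) (fun _ _ => Nat.zero_le _)
      (Finset.mem_univ g)).trans
    (Finset.single_le_sum (f := fun f => ∑ g, N f g) (fun _ _ => Nat.zero_le _)
      (Finset.mem_univ f))
  let a : s → s → MvPolynomial (Fin (n + 1)) ℂ := fun f g => (f.1 * g.1) ^ (M - N f g) * A f g
  have hGa : ∀ f g : s, ∀ w, w ≠ 0 → val f.1 w ≠ 0 → val g.1 w ≠ 0 →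
      val (a f g) w = (val f.1 w * val g.1 w) ^ M * G (τ f) (τ g) w := fun f g w hw hfw hgw => by
    rw [hGA f g w hw (by simpa [val] using ⟨hfw, hgw⟩)]
    simp only [a, val, map_mul, map_pow]
    simp only [val] at hfw hgw
    have : (eval w f.1 * eval w g.1) ^ M =
        (eval w f.1 * eval w g.1) ^ (M - N f g) * (eval w f.1 * eval w g.1) ^ N f g := by
      rw [← pow_add, Nat.sub_add_cancel (hNM f g)]
    rw [this]
    field_simp
  obtain ⟨H, hH, haH⟩ := exists_eq_sub_of_cocycle (A := s) hn (f := fun f => f.1 ^ M)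
    (e := fun f => e f * M) (d := d) (fun f => (hfe f).pow M) (fun f => pow_ne_zero M (hf0 f))
    (fun v hv => by
      obtain ⟨f, hf, hfv⟩ := hscov v hv
      exact ⟨⟨f, hf⟩, by simpa [val] using fun h => absurd h hfv⟩) (a := a)
    (fun f g => by
      have := (((hfe f).mul (hfe g)).pow (M - N f g)).mul (hA f g)
      rwa [← add_assoc, ← mul_add, Nat.sub_add_cancel (hNM f g), add_mul] at this)
    (fun f g h => by
      have : f.1 * g.1 * h.1 * (h.1 ^ M * a f g + f.1 ^ M * a g h - g.1 ^ M * a f h) = 0 :=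
        eq_zero_of_val_eq_zero fun v hv => by
          by_cases h1 : val f.1 v = 0
          · simp only [val] at h1
            simp [h1]
          by_cases h2 : val g.1 v = 0
          · simp only [val] at h2
            simp [h2]
          by_cases h3 : val h.1 v = 0
          · simp only [val] at h3
            simp [h3]
          have e1 := hGa f g v hv h1 h2
          have e2 := hGa g h v hv h2 h3
          have e3 := hGa f h v hv h1 h3
          have e4 := hcoc (τ f) (τ g) (τ h) v (hτ f v hv h1) (hτ g v hv h2) (hτ h v hv h3)
          simp only [val] at e1 e2 e3
          simp only [val, map_mul, map_sub, map_add, map_pow, e1, e2, e3, ← e4]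
          ring
      exact sub_eq_zero.1 ((mul_eq_zero.1 this).resolve_left
        (mul_ne_zero (mul_ne_zero (hf0 f) (hf0 g)) (hf0 h))))
  have hsplit : ∀ f g : s, ∀ w, w ≠ 0 → val f.1 w ≠ 0 → val g.1 w ≠ 0 →
      G (τ f) (τ g) w = val (H g) w / val (g.1 ^ M) w - val (H f) w / val (f.1 ^ M) w :=
    fun f g w hw hfw hgw => by
      have h1 := hGa f g w hw hfw hgw
      rw [haH f g] at h1
      simp only [val, map_sub, map_mul, map_pow] at h1 hfw hgw ⊢
      rw [div_sub_div _ _ (pow_ne_zero M hgw) (pow_ne_zero M hfw), eq_div_iff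
        (mul_ne_zero (pow_ne_zero M hgw) (pow_ne_zero M hfw))]
      rw [mul_pow] at h1
      linear_combination (-1 : ℂ) * h1
  have hpick : ∀ w : Fin (n + 1) → ℂ, ∃ f : s, w ≠ 0 → val f.1 w ≠ 0 := fun w => by
    by_cases hw : w = 0
    · obtain ⟨f, hf, -⟩ := hscov (Pi.single 0 1) (by simp)
      exact ⟨⟨f, hf⟩, fun h => absurd hw h⟩
    · obtain ⟨f, hf, hfw⟩ := hscov w hw
      exact ⟨⟨f, hf⟩, fun _ => hfw⟩
  choose φ hφ using hpick
  -- The splitting on the refinement is carried back to the original cover by adding G (τ f) i. By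
  -- the cocycle relation the result does not depend on which f with f(w) ≠ 0 is picked.
  let B : ι → (Fin (n + 1) → ℂ) → ℂ := fun i w =>
    val (H (φ w)) w / val ((φ w).1 ^ M) w + G (τ (φ w)) i w
  have hB : ∀ i, ∀ f : s, ∀ w ∈ C i, val f.1 w ≠ 0 →
      val (H f) w / val (f.1 ^ M) w + G (τ f) i w = B i w := fun i f w hw hfw => by
    have hw0 := hC0 i w hw
    have h1 := hsplit f (φ w) w hw0 hfw (hφ w hw0)
    have h2 := hcoc (τ f) (τ (φ w)) i w (hτ f w hw0 hfw) (hτ (φ w) w hw0 (hφ w hw0)) hw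
    simp only [B]
    linear_combination h1 - h2
  refine ⟨B, fun i => IsHomReg.of_local fun v hv => ?_, fun i j v hi hj => ?_⟩
  · have hv0 := hC0 i v hv
    obtain ⟨f, hf, hfv⟩ := hscov v hv0
    have hopen := (hC i).inter (isOpenCone_basic (hfe ⟨f, hf⟩))
    refine ⟨C i ∩ {w | w ≠ 0 ∧ val f w ≠ 0}, Set.inter_subset_left, ⟨hv, hv0, hfv⟩, ?_⟩
    have h1 := IsHomReg.div (hH ⟨f, hf⟩) ((hfe ⟨f, hf⟩).pow M) hopen
      (fun w hw => by simpa [val] using fun h => absurd h hw.2.2)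
    have h2 := (hG (τ ⟨f, hf⟩) i).mono hopen fun w hw => ⟨hτ ⟨f, hf⟩ w hw.2.1 hw.2.2, hw.1⟩
    exact (h1.add h2).congr fun w hw => hB i ⟨f, hf⟩ w hw.1 hw.2.2
  · have hv0 := hC0 i v hi
    have := hcoc (τ (φ v)) i j v (hτ (φ v) v hv0 (hφ v hv0)) hi hj
    simp only [B]
    linear_combination this

/-! ### The quadrics of t^⊥: base points, products with linear forms, linear syzygies. -/

theorem rank_le_one_of_eq_mul {T : Matrix (Fin (n + 1)) (Fin (n + 1)) ℂ} {a b : Fin (n + 1) → ℂ}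
    (h : ∀ j k, T j k = a j * b k) : T.rank ≤ 1 := by
  rw [show T = Matrix.vecMulVec a b from Matrix.ext h]
  exact Matrix.rank_vecMulVec_le a b

theorem rank_le_two_of_eq_add_mul {T : Matrix (Fin (n + 1)) (Fin (n + 1)) ℂ}
    {a b a' b' : Fin (n + 1) → ℂ} (h : ∀ j k, T j k = a j * b k + a' j * b' k) : T.rank ≤ 2 := by
  have : T = (Matrix.of ![a, a']).transpose * Matrix.of ![b, b'] := by
    ext j k
    simp [Matrix.mul_apply, h]
  rw [this]
  refine (Matrix.rank_mul_le_left _ _).trans ((Matrix.rank_le_card_width _).trans ?_)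
  simp

theorem sym_two_eq_span : Sym n 2 = Submodule.span ℂ
    (Set.range fun i : Fin (n + 1) × Fin (n + 1) => (X i.1 * X i.2 : MvPolynomial _ ℂ)) := by
  rw [Sym, ← homogeneousSubmodule_one_pow, homogeneousSubmodule_one_eq_span_X, pow_two,
    Submodule.span_mul_span]
  congr 1
  ext f
  simp [Set.mem_mul]

theorem sym_three_eq_span : Sym n 3 = Submodule.span ℂ
    (Set.range fun i : Fin (n + 1) × Fin (n + 1) × Fin (n + 1) =>
      (X i.1 * (X i.2.1 * X i.2.2) : MvPolynomial _ ℂ)) := by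
  rw [Sym, ← homogeneousSubmodule_one_pow, homogeneousSubmodule_one_eq_span_X, pow_succ', pow_two,
    Submodule.span_mul_span, Submodule.span_mul_span]
  congr 1
  ext f
  simp [Set.mem_mul]

theorem eq_on_sym_two {M : Type*} [AddCommGroup M] [Module ℂ M]
    {L L' : MvPolynomial (Fin (n + 1)) ℂ →ₗ[ℂ] M} (h : ∀ j k, L (X j * X k) = L' (X j * X k))
    {q : MvPolynomial (Fin (n + 1)) ℂ} (hq : q ∈ Sym n 2) : L q = L' q := by
  rw [sym_two_eq_span] at hq
  refine LinearMap.eqOn_span ?_ hq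
  rintro _ ⟨⟨j, k⟩, rfl⟩
  exact h j k

theorem val_add_of_mem_sym_one {l : MvPolynomial (Fin (n + 1)) ℂ} (hl : l ∈ Sym n 1)
    (a b : Fin (n + 1) → ℂ) : val l (a + b) = val l a + val l b := by
  rw [Sym, homogeneousSubmodule_one_eq_span_X] at hl
  induction hl using Submodule.span_induction with
  | mem f hf =>
    obtain ⟨i, rfl⟩ := hf
    simp [val]
  | zero => simp [val]
  | add f g _ _ hf hg =>
    simp only [val, map_add] at hf hg ⊢
    rw [hf, hg]
    ring
  | smul c f _ hf =>
    simp only [val, smul_eval] at hf ⊢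
    rw [hf]
    ring

/-- The contraction with a tensor of `S²V`, as a linear form on `S²V^∨`. -/
def contractForm (T : Matrix (Fin (n + 1)) (Fin (n + 1)) ℂ) :
    MvPolynomial (Fin (n + 1)) ℂ →ₗ[ℂ] ℂ :=
  (aeval (R := ℂ) (0 : Fin (n + 1) → ℂ)).toLinearMap ∘ₗ contract T

variable {T : Matrix (Fin (n + 1)) (Fin (n + 1)) ℂ}

theorem pderiv_X_mul_single (i i' j k : Fin (n + 1)) :
    pderiv i (X j * Pi.single (M := fun _ => MvPolynomial (Fin (n + 1)) ℂ) i' 1 k) =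
      C (if i = j ∧ i' = k then 1 else 0) := by
  by_cases h : i' = k
  · subst h
    by_cases h' : i = j
    · subst h'
      simp
    · simp [h', pderiv_X, Ne.symm h']
  · simp [h, Ne.symm h]

theorem pderiv_pderiv_X_mul_X (i i' j k : Fin (n + 1)) :
    pderiv i (pderiv i' (X j * X k : MvPolynomial (Fin (n + 1)) ℂ)) =
      C ((if i = j ∧ i' = k then 1 else 0) + if i = k ∧ i' = j then 1 else 0) := by
  rw [Derivation.leibniz, map_add, smul_eq_mul, smul_eq_mul, pderiv_X, pderiv_X,
    pderiv_X_mul_single, pderiv_X_mul_single, C_add]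

theorem contract_X_mul_X (hT : T.IsSymm) (j k : Fin (n + 1)) :
    contract T (X j * X k) = C (2 * T j k) := by
  simp only [contract, LinearMap.sum_apply, LinearMap.smul_apply, LinearMap.comp_apply,
    Derivation.coeFn_coe, pderiv_pderiv_X_mul_X, smul_eq_C_mul, ← C_mul, ← map_sum]
  congr 1
  simp only [mul_add, Finset.sum_add_distrib, mul_ite, mul_one, mul_zero, ite_and]
  simp [hT.apply j k, two_mul]

theorem contractForm_X_mul_X (hT : T.IsSymm) (j k : Fin (n + 1)) :
    contractForm T (X j * X k) = 2 * T j k := by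
  rw [contractForm, LinearMap.comp_apply, contract_X_mul_X hT]
  simp

/-- The contraction of a quadric is a constant polynomial, so evaluating it at 0 loses nothing. -/
theorem mem_orth_iff (hT : T.IsSymm) {q : MvPolynomial (Fin (n + 1)) ℂ} :
    q ∈ orth T ↔ q ∈ Sym n 2 ∧ contractForm T q = 0 := by
  refine and_congr_right fun hq => ?_
  have h : contract T q = C (contractForm T q) := by
    refine eq_on_sym_two (L' := Algebra.linearMap ℂ (MvPolynomial (Fin (n + 1)) ℂ) ∘ₗ
      contractForm T) (fun j k => ?_) hq
    rw [LinearMap.comp_apply, contractForm_X_mul_X hT, contract_X_mul_X hT]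
    rfl
  rw [SetLike.mem_coe, LinearMap.mem_ker, h, C_eq_zero]

/-- A linear form that vanishes on `t^⊥` is a multiple of the contraction with `t`. -/
theorem exists_eq_mul_contractForm (hT : T.IsSymm) (L : MvPolynomial (Fin (n + 1)) ℂ →ₗ[ℂ] ℂ)
    (hL : ∀ q ∈ orth T, L q = 0) : ∃ c, ∀ q ∈ Sym n 2, L q = c * contractForm T q := by
  by_cases h : ∃ q₀ ∈ Sym n 2, contractForm T q₀ ≠ 0
  · obtain ⟨q₀, hq₀, hc⟩ := h
    refine ⟨L q₀ / contractForm T q₀, fun q hq => ?_⟩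
    have := hL (q - (contractForm T q / contractForm T q₀) • q₀) ((mem_orth_iff hT).2
      ⟨Submodule.sub_mem _ hq (Submodule.smul_mem _ _ hq₀), by simp [hc]⟩)
    rw [map_sub, map_smul, smul_eq_mul, sub_eq_zero] at this
    rw [this]
    ring
  · push Not at h
    exact ⟨0, fun q hq => by rw [hL q ((mem_orth_iff hT).2 ⟨hq, h q hq⟩), zero_mul]⟩

theorem X_mul_X_mem (j k : Fin (n + 1)) : (X j * X k : MvPolynomial (Fin (n + 1)) ℂ) ∈ Sym n 2 :=
  (isHomogeneous_X ℂ j).mul (isHomogeneous_X ℂ k)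

/-- The quadrics of `t^⊥` have no common zeros if `t` has rank at least two. -/
theorem exists_mem_orth_val_ne_zero (hT : T.IsSymm) (hk : 2 ≤ T.rank) {v : Fin (n + 1) → ℂ}
    (hv : v ≠ 0) : ∃ q ∈ orth T, val q v ≠ 0 := by
  by_contra! h
  obtain ⟨c, hc⟩ := exists_eq_mul_contractForm hT (aeval (R := ℂ) v).toLinearMap
    (fun q hq => by simpa [aeval_eq_eval] using h q hq)
  -- At a base point v, evaluation is a multiple of the contraction; tested on monomials, this makes
  -- T a multiple of v vᵀ.
  have hvv : ∀ j k, v j * v k = c * (2 * T j k) := fun j k => by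
    have := hc _ (X_mul_X_mem j k)
    rw [contractForm_X_mul_X hT] at this
    simpa using this
  obtain ⟨i, hi⟩ := exists_ne_zero_of_ne_zero hv
  have hc0 : c ≠ 0 := by
    rintro rfl
    simpa [hi] using hvv i i
  have : T.rank ≤ 1 := rank_le_one_of_eq_mul (a := fun j => (2 * c)⁻¹ * v j) (b := v) fun j k => by
    rw [mul_assoc, hvv]
    field_simp
  omega

/-- The multiplication `V^∨ ⊗ t^⊥ → S³V^∨`. -/
def mulMap (T : Matrix (Fin (n + 1)) (Fin (n + 1)) ℂ) :
    (Fin (n + 1) → orth T) →ₗ[ℂ] MvPolynomial (Fin (n + 1)) ℂ :=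
  ∑ i, LinearMap.mulLeft ℂ (X i) ∘ₗ (orth T).subtype ∘ₗ LinearMap.proj i

theorem mulMap_apply (p : Fin (n + 1) → orth T) : mulMap T p = ∑ i, X i * (p i).1 := by
  simp [mulMap]

theorem mulMap_single (i : Fin (n + 1)) (q : orth T) : mulMap T (Pi.single i q) = X i * q.1 := by
  rw [mulMap_apply, Finset.sum_eq_single i]
  · simp
  · intro j _ hj
    simp [Pi.single_eq_of_ne hj]
  · simp

/-- The multiplication `V^∨ ⊗ t^⊥ → S³V^∨` is surjective if `t` has rank at least two. -/
theorem sym_three_le_range_mulMap (hT : T.IsSymm) (hk : 2 ≤ T.rank) :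
    Sym n 3 ≤ LinearMap.range (mulMap T) := by
  intro A hA
  by_contra hcon
  obtain ⟨f, hfA, hf⟩ := Submodule.exists_le_ker_of_notMem hcon
  have h1 : ∀ i, ∃ c, ∀ q ∈ Sym n 2, f (X i * q) = c * contractForm T q := fun i =>
    exists_eq_mul_contractForm hT (f ∘ₗ LinearMap.mulLeft ℂ (X i)) fun q hq =>
      hf ⟨Pi.single i ⟨q, hq⟩, mulMap_single i _⟩
  choose c hc using h1
  have h2 : ∀ i j k, f (X i * (X j * X k)) = c i * (2 * T j k) := fun i j k => by
    rw [hc i _ (X_mul_X_mem j k), contractForm_X_mul_X hT]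
  -- The cubic X_i X_j X_k does not depend on which factor is singled out. If some c_i is nonzero,
  -- all rows of T are then proportional to row i.
  have h3 : ∀ i j k, c i * T j k = c j * T i k := fun i j k => by
    have := (h2 i j k).symm.trans ((congrArg f (mul_left_comm _ _ _)).trans (h2 j i k))
    linear_combination this / 2
  have hc0 : c = 0 := by
    by_contra hne
    obtain ⟨i, hi⟩ := exists_ne_zero_of_ne_zero hne
    have : T.rank ≤ 1 := rank_le_one_of_eq_mul (a := c) (b := fun k => T i k / c i) fun j k => by
      have := h3 i j k
      field_simp
      linear_combination this
    omega
  apply hfA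
  rw [sym_three_eq_span] at hA
  refine (Submodule.span_le.2 ?_ : _ ≤ LinearMap.ker f) hA
  rintro _ ⟨⟨i, j, k⟩, rfl⟩
  simp [h2, hc0]

/-- If `t` has rank at least three, the linear syzygies of `t^⊥` generate the quadrics of `t^⊥`
through every point. -/
theorem exists_syzygy (hT : T.IsSymm) (hk : 3 ≤ T.rank) {v : Fin (n + 1) → ℂ} (hv : v ≠ 0)
    {p : MvPolynomial (Fin (n + 1)) ℂ} (hp : p ∈ orth T) (hpv : val p v = 0) :
    ∃ r : Fin (n + 1) → orth T, ∑ i, X i * (r i).1 = 0 ∧ ∑ i, v i • (r i).1 = p := by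
  let ν : (Fin (n + 1) → orth T) →ₗ[ℂ] MvPolynomial (Fin (n + 1)) ℂ :=
    ∑ i, v i • ((orth T).subtype ∘ₗ LinearMap.proj i)
  have hν : ∀ r, ν r = ∑ i, v i • (r i).1 := fun r => by simp [ν]
  have hνs : ∀ i q, ν (Pi.single i q) = v i • q.1 := fun i q => by
    rw [hν, Finset.sum_eq_single i]
    · simp
    · intro j _ hj
      simp [Pi.single_eq_of_ne hj]
    · simp
  suffices h : p ∈ (LinearMap.ker (mulMap T)).map ν by
    obtain ⟨r, hr, hrp⟩ := h
    exact ⟨r, by rw [← mulMap_apply]; exact hr, by rw [← hν]; exact hrp⟩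
  by_contra hcon
  obtain ⟨g, hgp, hg⟩ := Submodule.exists_le_ker_of_notMem hcon
  have hmem : g ∘ₗ ν ∈ (LinearMap.ker (mulMap T)).dualAnnihilator := by
    rw [Submodule.mem_dualAnnihilator]
    exact fun r hr => hg ⟨r, hr, rfl⟩
  -- A form g that kills all the values of syzygies but not p gives g ∘ ν vanishing on the kernel of
  -- the multiplication, hence of the form f ∘ `mulMap T`. It remains to show g(p) = 0.
  rw [← LinearMap.range_dualMap_eq_dualAnnihilator_ker] at hmem
  obtain ⟨f, hf⟩ := hmem
  have h1 : ∀ i, ∃ c, ∀ q ∈ Sym n 2, f (X i * q) - v i * g q = c * contractForm T q := fun i =>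
    exists_eq_mul_contractForm hT (f ∘ₗ LinearMap.mulLeft ℂ (X i) - v i • g) fun q hq => by
      have := LinearMap.congr_fun hf (Pi.single i ⟨q, hq⟩)
      rw [LinearMap.dualMap_apply, mulMap_single, LinearMap.comp_apply, hνs, map_smul] at this
      simp [this]
  choose c hc using h1
  have h2 : ∀ i j k, f (X i * (X j * X k)) = v i * g (X j * X k) + c i * (2 * T j k) :=
    fun i j k => by
      rw [← contractForm_X_mul_X hT, ← hc i _ (X_mul_X_mem j k)]
      ring
  have h3 : ∀ i j k, v i * g (X j * X k) + c i * (2 * T j k) =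
      v j * g (X i * X k) + c j * (2 * T i k) := fun i j k =>
    (h2 i j k).symm.trans ((congrArg f (mul_left_comm _ _ _)).trans (h2 j i k))
  obtain ⟨o, ho⟩ := exists_ne_zero_of_ne_zero hv
  -- the part of `c` that is not proportional to `v`
  let m : Fin (n + 1) → ℂ := fun i => c i - c o / v o * v i
  let G : Fin (n + 1) → Fin (n + 1) → ℂ := fun j k => g (X j * X k) + c o / v o * (2 * T j k)
  have h4 : ∀ i j k, v i * G j k + m i * (2 * T j k) = v j * G i k + m j * (2 * T i k) :=
    fun i j k => by
      simp only [G, m]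
      linear_combination h3 i j k
  have hmo : m o = 0 := by simp [m, ho]
  have h5 : ∀ i k, v o * G i k = v i * G o k + m i * (2 * T o k) := fun i k => by
    have := h4 i o k
    rw [hmo] at this
    linear_combination -this
  -- If some m_i is nonzero, eliminating G from `h4` by means of `h5` writes T as a sum of two
  -- products, with left vectors v and m, contrary to rank at least three.
  have hm0 : m = 0 := by
    by_contra hne
    obtain ⟨i, hi⟩ := exists_ne_zero_of_ne_zero hne
    have : T.rank ≤ 2 := rank_le_two_of_eq_add_mul (a := v) (b := fun k => T o k / v o)
      (a' := m) (b' := fun k => (T i k - v i * T o k / v o) / m i) fun j k => by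
        have e1 := h4 i j k
        have e2 := h5 i k
        have e3 := h5 j k
        have e4 : v o * m i * T j k = v j * m i * T o k + m j * (v o * T i k - v i * T o k) := by
          linear_combination (v o * e1 - v i * e3 + v j * e2) / 2
        field_simp
        linear_combination e4
    omega
  have hGsymm : ∀ j k, G j k = G k j := fun j k => by
    simp only [G]
    rw [mul_comm (X j), hT.apply]
  have h6 : ∀ j k, G j k = G o o / v o ^ 2 * (v j * v k) := fun j k => by
    have e1 := h5 j k
    have e2 := h5 k o
    rw [hm0] at e1 e2
    rw [hGsymm o k] at e1
    simp only [Pi.zero_apply] at e1 e2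
    field_simp
    linear_combination v o * e1 + v j * e2
  -- Once m = 0, g is a combination of the contraction with t and the evaluation at v, and both of
  -- these kill p.
  have h7 : (g + (c o / v o) • contractForm T) p = ((G o o / v o ^ 2) • (aeval v).toLinearMap) p :=
    eq_on_sym_two (fun j k => by
      have := h6 j k
      simp only [G] at this
      simp only [LinearMap.add_apply, LinearMap.smul_apply, contractForm_X_mul_X hT, smul_eq_mul,
        AlgHom.toLinearMap_apply, map_mul, aeval_X]
      exact this) ((mem_orth_iff hT).1 hp).1
  apply hgp
  simp only [val] at hpv
  simpa [((mem_orth_iff hT).1 hp).2, aeval_eq_eval, hpv] using h7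

/-! ### Quadric tensors of rank two. -/

theorem exists_dotProduct_mulVec_ne_zero (hT : T.IsSymm) (h0 : T ≠ 0) :
    ∃ y, y ⬝ᵥ T.mulVec y ≠ 0 := by
  by_contra! h
  have hd : ∀ i, T i i = 0 := fun i => by
    have := h (Pi.single i 1)
    simpa using this
  refine h0 (Matrix.ext fun i j => ?_)
  have := h (Pi.single i 1 + Pi.single j 1)
  simp only [Matrix.mulVec_add, add_dotProduct, dotProduct_add, Matrix.mulVec_single_one,
    single_one_dotProduct, Matrix.col_apply, hd, hT.apply i j] at this
  simp only [Matrix.zero_apply]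
  linear_combination this / 2

/-- Completing the square: choose y with yᵀTy = c² ≠ 0 and put u = Ty / c. Subtracting u uᵀ keeps
the kernel of T and adds y to it. -/
theorem exists_rank_sub_vecMulVec_lt (hT : T.IsSymm) (h0 : T ≠ 0) :
    ∃ u, (T - Matrix.vecMulVec u u).IsSymm ∧ (T - Matrix.vecMulVec u u).rank < T.rank := by
  obtain ⟨y, hy⟩ := exists_dotProduct_mulVec_ne_zero hT h0
  obtain ⟨c, hc⟩ := IsAlgClosed.exists_pow_nat_eq (y ⬝ᵥ T.mulVec y) (n := 2) two_pos
  have hc0 : c ≠ 0 := by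
    rintro rfl
    exact hy (by simpa using hc.symm)
  let u := c⁻¹ • T.mulVec y
  have happ : ∀ x, (T - Matrix.vecMulVec u u).mulVec x =
      T.mulVec x - (c⁻¹ * c⁻¹ * (y ⬝ᵥ T.mulVec x)) • T.mulVec y := fun x => by
    have : T.mulVec y ⬝ᵥ x = y ⬝ᵥ T.mulVec x := by
      rw [Matrix.dotProduct_mulVec, ← Matrix.mulVec_transpose, hT.eq]
    rw [Matrix.sub_mulVec, Matrix.vecMulVec_mulVec]
    ext i
    simp only [u, smul_dotProduct, this, Pi.sub_apply, Pi.smul_apply, smul_eq_mul,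
      MulOpposite.smul_eq_mul_unop, MulOpposite.unop_op]
    ring
  refine ⟨u, ?_, ?_⟩
  · refine hT.sub ?_
    ext i j
    simp [Matrix.vecMulVec_apply, mul_comm]
  · have hlt : LinearMap.ker T.mulVecLin < LinearMap.ker (T - Matrix.vecMulVec u u).mulVecLin := by
      refine lt_of_le_of_ne (fun x hx => ?_) fun heq => ?_
      · rw [LinearMap.mem_ker, Matrix.mulVecLin_apply] at hx ⊢
        rw [happ, hx]
        simp
      · have hmem : y ∈ LinearMap.ker (T - Matrix.vecMulVec u u).mulVecLin := by
          rw [LinearMap.mem_ker, Matrix.mulVecLin_apply, happ, ← hc,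
            show c⁻¹ * c⁻¹ * c ^ 2 = 1 by field_simp, one_smul, sub_self]
        rw [← heq, LinearMap.mem_ker, Matrix.mulVecLin_apply] at hmem
        exact hy (by simp [hmem])
    have h1 := Submodule.finrank_lt_finrank_of_lt hlt
    have h2 := LinearMap.finrank_range_add_finrank_ker T.mulVecLin
    have h3 := LinearMap.finrank_range_add_finrank_ker (T - Matrix.vecMulVec u u).mulVecLin
    simp only [Matrix.rank]
    omega

theorem eq_zero_of_rank_eq_zero (h : T.rank = 0) : T = 0 := by
  rw [Matrix.rank, Submodule.finrank_eq_zero, LinearMap.range_eq_bot] at h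
  ext i j
  have := congrFun (LinearMap.congr_fun h (Pi.single j 1)) i
  simpa using this

/-- A quadric tensor of rank two is a product of two vectors. -/
theorem exists_eq_add_of_rank_eq_two (hT : T.IsSymm) (hk : T.rank = 2) :
    ∃ a b : Fin (n + 1) → ℂ, a ≠ 0 ∧ b ∉ Submodule.span ℂ {a} ∧
      ∀ j k, T j k = a j * b k + b j * a k := by
  obtain ⟨u, hu, hur⟩ := exists_rank_sub_vecMulVec_lt hT (by rintro rfl; simp at hk)
  obtain ⟨w, hw⟩ : ∃ w, T - Matrix.vecMulVec u u = Matrix.vecMulVec w w := by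
    by_cases h0 : T - Matrix.vecMulVec u u = 0
    · exact ⟨0, by simp [h0]⟩
    · obtain ⟨w, -, hwr⟩ := exists_rank_sub_vecMulVec_lt hu h0
      exact ⟨w, sub_eq_zero.1 (eq_zero_of_rank_eq_zero (by omega))⟩
  have hTuw : ∀ j k, T j k = u j * u k + w j * w k := fun j k => by
    have := congrFun (congrFun hw j) k
    simp only [Matrix.sub_apply, Matrix.vecMulVec_apply] at this
    linear_combination this
  -- The factorization u² + w² = (u + iw)(u - iw). The vector w may still be zero here; the rank
  -- excludes this when the independence of the factors is proved.
  have hTab : ∀ j k, T j k = (u + Complex.I • w) j * ((2 : ℂ)⁻¹ • (u - Complex.I • w)) k +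
      ((2 : ℂ)⁻¹ • (u - Complex.I • w)) j * (u + Complex.I • w) k := fun j k => by
    simp only [Pi.add_apply, Pi.smul_apply, Pi.sub_apply, smul_eq_mul]
    rw [hTuw]
    linear_combination (w j * w k) * Complex.I_sq
  generalize u + Complex.I • w = a at hTab
  generalize (2 : ℂ)⁻¹ • (u - Complex.I • w) = b at hTab
  refine ⟨a, b, ?_, fun hb => ?_, hTab⟩
  · rintro rfl
    have : T = 0 := Matrix.ext fun j k => by simp [hTab]
    simp [this] at hk
  · obtain ⟨c, rfl⟩ := Submodule.mem_span_singleton.1 hb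
    have : T.rank ≤ 1 := rank_le_one_of_eq_mul (a := fun j => 2 * c * a j) (b := a) fun j k => by
      rw [hTab]
      simp only [Pi.smul_apply, smul_eq_mul]
      ring
    omega

/-- The mixed term of q(a + s b) is s / 2 times the contraction of q with t, which is zero on t^⊥.
-/
theorem val_add_smul_of_mem_orth (hT : T.IsSymm) {a b : Fin (n + 1) → ℂ}
    (hab : ∀ j k, T j k = a j * b k + b j * a k) {q : MvPolynomial (Fin (n + 1)) ℂ}
    (hq : q ∈ orth T) (s : ℂ) : val q (a + s • b) = val q a + s ^ 2 * val q b := by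
  obtain ⟨hq2, hq0⟩ := (mem_orth_iff hT).1 hq
  have : (aeval (R := ℂ) (a + s • b)).toLinearMap q = ((aeval (R := ℂ) a).toLinearMap +
      s ^ 2 • (aeval (R := ℂ) b).toLinearMap + (s / 2) • contractForm T) q :=
    eq_on_sym_two (fun j k => by
      simp only [LinearMap.add_apply, LinearMap.smul_apply, contractForm_X_mul_X hT, smul_eq_mul,
        AlgHom.toLinearMap_apply, map_mul, aeval_X, hab, Pi.add_apply, Pi.smul_apply]
      ring) hq2
  simpa [hq0, aeval_eq_eval] using this

/-- The quadric is l² for a linear form l with l(a) = 0 and l(b) ≠ 0; its contraction with t is 4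
l(a) l(b) = 0. -/
theorem exists_mem_orth_of_eq_add (hT : T.IsSymm) {a b : Fin (n + 1) → ℂ}
    (hab : ∀ j k, T j k = a j * b k + b j * a k) (hb : b ∉ Submodule.span ℂ {a}) :
    ∃ p ∈ orth T, val p a = 0 ∧ val p b ≠ 0 := by
  obtain ⟨g, hgb, hga⟩ := Submodule.exists_le_ker_of_notMem hb
  have hga : g a = 0 := hga (Submodule.mem_span_singleton_self a)
  let l : MvPolynomial (Fin (n + 1)) ℂ := ∑ i, C (g (Pi.single i 1)) * X i
  have hl : ∀ v, val l v = g v := fun v => by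
    conv_rhs => rw [← Finset.univ_sum_single v, map_sum]
    simp only [l, val, map_sum, map_mul, eval_C, eval_X]
    refine Finset.sum_congr rfl fun i _ => ?_
    rw [mul_comm, ← smul_eq_mul, ← map_smul, ← Pi.single_smul, smul_eq_mul, mul_one]
  have hlh : l.IsHomogeneous 1 := IsHomogeneous.sum _ _ _ fun i _ => by
    have := (isHomogeneous_C (Fin (n + 1)) (g (Pi.single i 1))).mul (isHomogeneous_X ℂ i)
    rwa [zero_add] at this
  have hc : contractForm T (l * l) = 0 := by
    have h1 : contractForm T (l * l) = ∑ i, ∑ j, (g (Pi.single i 1) * g (Pi.single j 1)) *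
        (2 * (a i * b j + b i * a j)) := by
      simp only [l, Finset.sum_mul_sum, map_sum]
      refine Finset.sum_congr rfl fun i _ => Finset.sum_congr rfl fun j _ => ?_
      rw [mul_mul_mul_comm, ← C_mul, ← smul_eq_C_mul, map_smul, contractForm_X_mul_X hT, hab,
        smul_eq_mul]
    have h2 : val l a * val l b = ∑ i, ∑ j, (g (Pi.single i 1) * g (Pi.single j 1)) *
        (a i * b j) := by
      simp only [l, val, map_sum, map_mul, eval_C, eval_X, Finset.sum_mul_sum]
      exact Finset.sum_congr rfl fun i _ => Finset.sum_congr rfl fun j _ => by ring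
    have h3 : val l b * val l a = ∑ i, ∑ j, (g (Pi.single i 1) * g (Pi.single j 1)) *
        (b i * a j) := by
      simp only [l, val, map_sum, map_mul, eval_C, eval_X, Finset.sum_mul_sum]
      exact Finset.sum_congr rfl fun i _ => Finset.sum_congr rfl fun j _ => by ring
    have h4 : contractForm T (l * l) = 2 * (val l a * val l b + val l b * val l a) := by
      rw [h1, h2, h3, ← Finset.sum_add_distrib, Finset.mul_sum]
      refine Finset.sum_congr rfl fun i _ => ?_
      rw [← Finset.sum_add_distrib, Finset.mul_sum]
      exact Finset.sum_congr rfl fun j _ => by ring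
    rw [h4, hl, hga]
    ring
  refine ⟨l * l, (mem_orth_iff hT).2 ⟨hlh.mul hlh, hc⟩, ?_, ?_⟩
  · have := hl a
    simp only [val] at this
    simp [val, this, hga]
  · have := hl b
    simp only [val] at this
    simpa [val, this] using hgb

/-! ### Dictionary between open subsets of ℙⁿ and open cones. -/

/-- The cone over an open subset of `ℙⁿ`, without its vertex. -/
def cone (U : Opens (PP n)) : Set (Fin (n + 1) → ℂ) :=
  {v | ∃ h : v ≠ 0, Projectivization.mk ℂ v h ∈ U}

theorem mk_punct {x : PP n} (v : Punct x) : Projectivization.mk ℂ v.1 v.2.2 = x := by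
  apply Projectivization.submodule_injective
  have hx : line x = Submodule.span ℂ {(rep x).1} := Projectivization.submodule_eq x
  obtain ⟨c, hc⟩ := exists_smul_eq v (rep x)
  rw [Projectivization.submodule_mk]
  refine le_antisymm ?_ ?_
  · rw [Submodule.span_singleton_le_iff_mem]
    exact v.2.1
  · refine hx.le.trans ?_
    rw [Submodule.span_singleton_le_iff_mem, ← hc]
    exact Submodule.smul_mem _ _ (Submodule.mem_span_singleton_self _)

/-- A nonzero vector as a vector of the line that it spans. -/
def toPunct {v : Fin (n + 1) → ℂ} (hv : v ≠ 0) : Punct (Projectivization.mk ℂ v hv) :=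
  ⟨v, by
    rw [line, Projectivization.submodule_mk]
    exact Submodule.mem_span_singleton_self v, hv⟩

theorem mem_cone {U : Opens (PP n)} {x : PP n} (v : Punct x) : v.1 ∈ cone U ↔ x ∈ U := by
  refine ⟨fun ⟨h, hv⟩ => ?_, fun hx => ⟨v.2.2, ?_⟩⟩
  · rwa [mk_punct v] at hv
  · rwa [mk_punct v]

theorem cone_inf (U W : Opens (PP n)) : cone (U ⊓ W) = cone U ∩ cone W := by
  ext v
  exact ⟨fun ⟨h, h1, h2⟩ => ⟨⟨h, h1⟩, h, h2⟩, fun ⟨⟨h, h1⟩, _, h2⟩ => ⟨h, h1, h2⟩⟩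

theorem cone_mono {U W : Opens (PP n)} (h : W ≤ U) : cone W ⊆ cone U :=
  fun _ ⟨hv, hW⟩ => ⟨hv, h hW⟩

theorem cone_top : cone (⊤ : Opens (PP n)) = {v | v ≠ 0} := by
  ext v
  exact ⟨fun ⟨h, _⟩ => h, fun h => ⟨h, trivial⟩⟩

theorem exists_punct_of_mem_cone {U : Opens (PP n)} {v : Fin (n + 1) → ℂ} (hv : v ∈ cone U) :
    ∃ (x : U) (w : Punct x.1), w.1 = v :=
  ⟨⟨_, hv.2⟩, toPunct hv.1, rfl⟩

theorem ne_zero_of_smul_eq_punct {x : PP n} {v w : Punct x} {c : ℂ} (h : c • v.1 = w.1) :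
    c ≠ 0 := by
  rintro rfl
  exact w.2.2 (by simpa using h.symm)

theorem val_ne_zero_iff {d : ℕ} {f : MvPolynomial (Fin (n + 1)) ℂ} (hf : f.IsHomogeneous d)
    {x : PP n} (v w : Punct x) : val f v ≠ 0 ↔ val f w ≠ 0 := by
  obtain ⟨c, hc⟩ := exists_smul_eq v w
  have hc0 := ne_zero_of_smul_eq_punct hc
  rw [← hc, val_smul hf]
  simp [hc0]

/-- The basic open set `D(f)`. -/
def basicOpen {d : ℕ} (f : MvPolynomial (Fin (n + 1)) ℂ) (hf : f.IsHomogeneous d) : Opens (PP n) :=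
  ⟨{x | ∀ v : Punct x, val f v ≠ 0}, isOpen_generateFrom_of_mem ⟨d, f, hf, rfl⟩⟩

theorem mem_basicOpen {d : ℕ} {f : MvPolynomial (Fin (n + 1)) ℂ} {hf : f.IsHomogeneous d}
    {x : PP n} (v : Punct x) : x ∈ basicOpen f hf ↔ val f v ≠ 0 :=
  ⟨fun h => h v, fun h w => (val_ne_zero_iff hf v w).1 h⟩

/-- The D(f) are closed under finite intersections, by multiplying the polynomials, so they form a
base of the topology that they generate. -/
theorem isOpenCone_cone (U : Opens (PP n)) : IsOpenCone (cone U) := by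
  have : ∀ S : Set (PP n), IsOpen S →
      IsOpenCone {v : Fin (n + 1) → ℂ | ∃ h : v ≠ 0, Projectivization.mk ℂ v h ∈ S} := by
    intro S hS
    induction hS with
    | basic S hS =>
      obtain ⟨d, f, hf, rfl⟩ := hS
      rintro v ⟨hv, hvS⟩
      exact ⟨d, f, hf, hvS (toPunct hv), fun w hw hfw => ⟨hw, fun u =>
        (val_ne_zero_iff hf (toPunct hw) u).1 hfw⟩⟩
    | univ => exact fun v ⟨hv, _⟩ => ⟨0, 1, isHomogeneous_one _ _, by simp [val],
        fun w hw _ => ⟨hw, trivial⟩⟩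
    | inter S S' _ _ ih ih' =>
      rintro v ⟨hv, h1, h2⟩
      obtain ⟨q, b, hb, hbv, H⟩ := ih.inter ih' v ⟨⟨hv, h1⟩, hv, h2⟩
      exact ⟨q, b, hb, hbv, fun w hw hbw => ⟨hw, (H w hw hbw).1.2, (H w hw hbw).2.2⟩⟩
    | sUnion A _ ih =>
      rintro v ⟨hv, S, hS, hvS⟩
      obtain ⟨q, b, hb, hbv, H⟩ := ih S hS v ⟨hv, hvS⟩
      exact ⟨q, b, hb, hbv, fun w hw hbw => ⟨hw, S, hS, (H w hw hbw).2⟩⟩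
  exact this U U.2

theorem isHomReg_zero_of_isRegular {U : Opens (PP n)} {φ : U → ℂ} {F : (Fin (n + 1) → ℂ) → ℂ}
    (hF : ∀ (x : U) (v : Punct x.1), F v.1 = φ x) (hφ : IsRegular φ) : IsHomReg 0 (cone U) F := by
  refine IsHomReg.of_local fun v hv => ?_
  obtain ⟨x, v, rfl⟩ := exists_punct_of_mem_cone hv
  obtain ⟨W, h, hx, d, a, b, ha, hb, H⟩ := hφ x
  refine ⟨cone W, cone_mono h, (mem_cone v).2 hx, ?_⟩
  refine (IsHomReg.div (d := 0) (q := d) ha hb (isOpenCone_cone W) fun w hw => ?_).congr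
    fun w hw => ?_
  · obtain ⟨y, w, rfl⟩ := exists_punct_of_mem_cone hw
    exact (H y w).1
  · obtain ⟨y, w, rfl⟩ := exists_punct_of_mem_cone hw
    rw [hF ⟨y, h y.2⟩ w, (H y w).2]

theorem isRegular_of_isHomReg_zero {U : Opens (PP n)} {φ : U → ℂ} {F : (Fin (n + 1) → ℂ) → ℂ}
    (hφ : ∀ (x : U) (v : Punct x.1), φ x = F v.1) (hF : IsHomReg 0 (cone U) F) : IsRegular φ := by
  intro x
  obtain ⟨q, a, b, ha, hb, hbv, K⟩ := hF (rep x.1).1 ((mem_cone _).2 x.2)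
  refine ⟨U ⊓ basicOpen b hb, inf_le_left, ⟨x.2, (mem_basicOpen _).2 hbv⟩, q, a, b, ha, hb,
    fun y v => ?_⟩
  have h1 := (mem_basicOpen v).1 y.2.2
  exact ⟨h1, (hφ _ v).trans (K v.1 v.2.2 h1).2⟩

namespace IsHomReg

variable {d : ℕ} {C : Set (Fin (n + 1) → ℂ)} {F : (Fin (n + 1) → ℂ) → ℂ}

theorem smul_eq (hF : IsHomReg d C F) {v : Fin (n + 1) → ℂ} (hv : v ∈ C) (hv0 : v ≠ 0) {c : ℂ}
    (hc : c ≠ 0) : F (c • v) = c ^ d * F v := by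
  obtain ⟨q, a, b, ha, hb, hbv, K⟩ := hF v hv
  have h1 : val b (c • v) = c ^ q * val b v := val_smul hb c v
  rw [(K v hv0 hbv).2, (K (c • v) (smul_ne_zero hc hv0) (by
    rw [h1]; exact mul_ne_zero (pow_ne_zero q hc) hbv)).2, h1, val_smul ha, pow_add, mul_assoc,
    mul_div_mul_left _ _ (pow_ne_zero q hc), mul_div_assoc]

theorem div_coord (hF : IsHomReg 1 C F) {i : Fin (n + 1)}
    (hi : ∀ v ∈ C, v i ≠ 0) : IsHomReg 0 C (fun v => F v / v i) := by
  intro v hv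
  obtain ⟨q, a, b, ha, hb, hbv, K⟩ := hF v hv
  refine ⟨q + 1, a, b * X i, ha, hb.mul (isHomogeneous_X ℂ i), by simpa [val] using ⟨hbv, hi v hv⟩,
    fun w hw hbw => ?_⟩
  simp only [val, map_mul, eval_X, mul_ne_zero_iff] at hbw ⊢
  refine ⟨(K w hw hbw.1).1, ?_⟩
  rw [(K w hw hbw.1).2, div_div]

end IsHomReg

theorem isRegular_quot {U : Opens (PP n)} {d : ℕ} {a b : MvPolynomial (Fin (n + 1)) ℂ}
    (ha : a.IsHomogeneous d) (hb : b.IsHomogeneous d) (hU : U ≤ basicOpen b hb) :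
    IsRegular (fun y : U => val a (rep y.1) / val b (rep y.1)) := fun y =>
  ⟨U, le_rfl, y.2, d, a, b, ha, hb, fun z v => ⟨hU z.2 v, quot_eq ha hb _ _⟩⟩

theorem IsRegular.sum {κ : Type*} (s : Finset κ) {U : Opens (PP n)} {φ : κ → U → ℂ}
    (h : ∀ i ∈ s, IsRegular (φ i)) : IsRegular (fun x => ∑ i ∈ s, φ i x) := by
  classical
  induction s using Finset.induction_on with
  | empty => simpa using IsRegular.const 0
  | insert i s hi ih =>
    simp only [Finset.sum_insert hi]
    exact (h i (by simp)).add (ih fun j hj => h j (by simp [hj]))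

/-! ### E_P as a vector bundle and its presentation. -/

section Bundle

variable {c : ℕ} {P : Submodule ℂ (MvPolynomial (Fin (n + 1)) ℂ)}

/-- The evaluation at a vector, as a linear form on `P`. -/
def evDual (P : Submodule ℂ (MvPolynomial (Fin (n + 1)) ℂ)) (v : Fin (n + 1) → ℂ) : Dual ℂ P :=
  (aeval (R := ℂ) v).toLinearMap ∘ₗ P.subtype

theorem evDual_apply (v : Fin (n + 1) → ℂ) (q : P) : evDual P v q = val q.1 v := by
  simp [evDual, aeval_eq_eval]

theorem isHomogeneous_of_mem (hP : P ≤ Sym n c) (q : P) : q.1.IsHomogeneous c :=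
  (mem_homogeneousSubmodule _ _).1 (hP q.2)

theorem evalMap_eq_smul (x : PP n) (φ : (Fam.trivial n ℂ).twistFib (-c) x) {z : ℂ}
    (hz : φ.1 (rep x) = z) : evalMap P c x φ = z • evDual P (rep x).1 := by
  ext q
  rw [LinearMap.smul_apply, evDual_apply]
  exact (congrArg (fun z : ℂ => val q.1 (rep x).1 * z) hz).trans (mul_comm _ _)

theorem range_evalMap (hP : P ≤ Sym n c) {x : PP n} (v : Punct x) :
    LinearMap.range (evalMap P c x) = Submodule.span ℂ {evDual P v.1} := by
  obtain ⟨k, hk⟩ := exists_smul_eq v (rep x)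
  have hk0 := ne_zero_of_smul_eq_punct hk
  have hrep : evDual P (rep x).1 = k ^ c • evDual P v.1 := by
    ext q
    rw [LinearMap.smul_apply, evDual_apply, evDual_apply, ← hk,
      val_smul (isHomogeneous_of_mem hP q), smul_eq_mul]
  refine le_antisymm ?_ ?_
  · rintro _ ⟨φ, rfl⟩
    obtain ⟨z, hz⟩ : ∃ z : ℂ, φ.1 (rep x) = z := ⟨_, rfl⟩
    rw [evalMap_eq_smul x φ hz, hrep, smul_smul]
    exact Submodule.smul_mem _ _ (Submodule.mem_span_singleton_self _)
  · rw [Submodule.span_singleton_le_iff_mem]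
    obtain ⟨i, hi⟩ := exists_ne_zero_of_ne_zero v.2.2
    -- The element of the fibre of 𝒪(-c) with value 1 at v; its image is evaluation at v.
    let φ : (Fam.trivial n ℂ).twistFib (-c) x := ⟨fun w => ((w.1 i / v.1 i) ^ (-(c : ℤ)) : ℂ), by
      intro a u w h
      change ((w.1 i / v.1 i) ^ (-(c : ℤ)) : ℂ) = a ^ (-(c : ℤ)) * (u.1 i / v.1 i) ^ (-(c : ℤ))
      rw [h, ← mul_zpow, Pi.smul_apply, smul_eq_mul, mul_div_assoc]⟩
    refine ⟨φ, ?_⟩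
    have hφ : φ.1 (rep x) = (k ^ (-(c : ℤ)) : ℂ) := by
      change ((rep x).1 i / v.1 i) ^ (-(c : ℤ)) = _
      rw [← hk, Pi.smul_apply, smul_eq_mul, mul_div_cancel_right₀ _ hi]
    rw [evalMap_eq_smul x φ hφ, hrep, smul_smul, zpow_neg, zpow_natCast,
      inv_mul_cancel₀ (pow_ne_zero c hk0), one_smul]

theorem evalMap_injective (hbp : ∀ v : Fin (n + 1) → ℂ, v ≠ 0 → ∃ q ∈ P, val q v ≠ 0) (x : PP n) :
    Function.Injective (evalMap P c x) := by
  rw [injective_iff_map_eq_zero]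
  intro φ hφ
  obtain ⟨q, hq, hqv⟩ := hbp (rep x).1 (rep x).2.2
  obtain ⟨z, hz⟩ : ∃ z : ℂ, φ.1 (rep x) = z := ⟨_, rfl⟩
  have h1 : z = 0 := by
    have := LinearMap.congr_fun hφ ⟨q, hq⟩
    rw [evalMap_eq_smul x φ hz, LinearMap.smul_apply, evDual_apply] at this
    exact (mul_eq_zero.1 this).resolve_right hqv
  refine Subtype.ext (funext fun v => ?_)
  obtain ⟨k, hk⟩ := exists_smul_eq (rep x) v
  rw [φ.2 k (rep x) v hk.symm]
  exact (congrArg (fun z : ℂ => k ^ (-(c : ℤ)) * z) (hz.trans h1)).trans (mul_zero _)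

/-- The projection of `P^∨` to a fibre of `E_P`. -/
def quotMk (hP : P ≤ Sym n c) (x : PP n) : Dual ℂ P →ₗ[ℂ] (EP P hP).fib x :=
  (LinearMap.range (evalMap P c x)).mkQ

theorem quotMk_surjective (hP : P ≤ Sym n c) (x : PP n) : Function.Surjective (quotMk hP x) :=
  Submodule.mkQ_surjective _

theorem ker_quotMk (hP : P ≤ Sym n c) {x : PP n} (v : Punct x) :
    LinearMap.ker (quotMk hP x) = Submodule.span ℂ {evDual P v.1} := by
  rw [← range_evalMap hP v]
  exact Submodule.ker_mkQ _

theorem quotMk_evDual (hP : P ≤ Sym n c) {x : PP n} (v : Punct x) :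
    quotMk hP x (evDual P v.1) = 0 := by
  rw [← LinearMap.mem_ker, ker_quotMk hP v]
  exact Submodule.mem_span_singleton_self _

theorem mem_reg_EP {hP : P ≤ Sym n c} {U : Opens (PP n)} {s : ∀ x : U, (EP P hP).fib x} :
    s ∈ (EP P hP).reg U ↔ ∀ x : U, ∃ (W : Opens (PP n)) (h : W ≤ U), x.1 ∈ W ∧
      ∃ t ∈ (Fam.trivial n (Dual ℂ P)).reg W, ∀ y : W, s ⟨y, h y.2⟩ = quotMk hP y (t y) :=
  Iff.rfl

theorem const_mem_reg_trivial {W : Type} [AddCommGroup W] [Module ℂ W] (U : Opens (PP n)) (w : W) :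
    (fun _ : U => w) ∈ (Fam.trivial n W).reg U :=
  fun _ => IsRegular.const _

theorem quotMk_const_mem_reg (hP : P ≤ Sym n c) (U : Opens (PP n)) (ℓ : Dual ℂ P) :
    (fun x : U => quotMk hP x.1 ℓ) ∈ (EP P hP).reg U :=
  mem_reg_EP.2 fun x => ⟨U, le_rfl, x.2, _, const_mem_reg_trivial U ℓ, fun _ => rfl⟩

/-- The linear form on a fibre of `E_P` defined by a form of `P` that vanishes at the point. -/
def fibDual (hP : P ≤ Sym n c) (x : PP n) (p : P) (hp : val p.1 (rep x).1 = 0) :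
    Dual ℂ ((EP P hP).fib x) :=
  (LinearMap.range (evalMap P c x)).liftQ (Dual.eval ℂ P p) (by
    rw [range_evalMap hP (rep x), Submodule.span_singleton_le_iff_mem, LinearMap.mem_ker,
      Dual.eval_apply, evDual_apply, hp])

theorem fibDual_quotMk (hP : P ≤ Sym n c) (x : PP n) (p : P) (hp : val p.1 (rep x).1 = 0)
    (ℓ : Dual ℂ P) : fibDual hP x p hp (quotMk hP x ℓ) = ℓ p :=
  rfl

theorem val_rep_eq_zero (hP : P ≤ Sym n c) {x : PP n} {v : Punct x} {p : P}
    (hp : val p.1 v.1 = 0) : val p.1 (rep x).1 = 0 := by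
  obtain ⟨k, hk⟩ := exists_smul_eq v (rep x)
  rw [← hk, val_smul (isHomogeneous_of_mem hP p), hp, mul_zero]

/-- Where the basis form `bas i₀` does not vanish, evaluation at the point has a nonzero
`i₀`-coordinate. The classes of the other dual basis vectors therefore give a frame of the quotient.
-/
theorem isVectorBundle_EP (hP : P ≤ Sym n c)
    (hbp : ∀ v : Fin (n + 1) → ℂ, v ≠ 0 → ∃ q ∈ P, val q v ≠ 0) {e : ℕ}
    (bas : Basis (Fin (e + 1)) ℂ P) : (EP P hP).IsVectorBundle e := by
  intro x
  obtain ⟨i₀, hi₀⟩ : ∃ i, val (bas i).1 (rep x).1 ≠ 0 := by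
    by_contra! h
    obtain ⟨q, hq, hqv⟩ := hbp (rep x).1 (rep x).2.2
    have : evDual P (rep x).1 = 0 := bas.ext fun i => by rw [evDual_apply, h i]; rfl
    have := LinearMap.congr_fun this ⟨q, hq⟩
    rw [evDual_apply] at this
    exact hqv this
  have hom := isHomogeneous_of_mem hP
  let U : Opens (PP n) := basicOpen (bas i₀).1 (hom (bas i₀))
  let r : Fin e → P := fun i => bas (i₀.succAbove i)
  let δ : Fin e → Dual ℂ P := fun i => bas.coord (i₀.succAbove i)
  have hδ : ∀ i j, δ j (r i) = if i = j then 1 else 0 := fun i j => by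
    simp [δ, r, Finsupp.single_apply, (Fin.succAbove_right_injective (p := i₀)).eq_iff]
  have hδ₀ : ∀ j, δ j (bas i₀) = 0 := fun j => by
    simp [δ]
  -- The forms that give the coordinates in the frame δ: r i is corrected by a multiple of `bas i₀`
  -- so as to vanish at y and descend to the fibre of E_P.
  let ρ : Fin e → PP n → P := fun i y =>
    r i - (val (r i).1 (rep y).1 / val (bas i₀).1 (rep y).1) • bas i₀
  have hρ : ∀ i (y : U), val (ρ i y.1).1 (rep y.1).1 = 0 := fun i y => by
    have := y.2 (rep y.1)
    simp only [val] at this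
    simp [ρ, val, smul_eval, this]
  have hpair : ∀ i (y : U) ℓ, fibDual hP y (ρ i y.1) (hρ i y) (quotMk hP y ℓ) =
      ℓ (r i) - (val (r i).1 (rep y.1).1 / val (bas i₀).1 (rep y.1).1) * ℓ (bas i₀) :=
    fun i y ℓ => by
      rw [fibDual_quotMk]
      simp [ρ]
  have hexp : ∀ (y : U) (t : (EP P hP).fib y.1),
      t = ∑ i, fibDual hP y (ρ i y.1) (hρ i y) t • quotMk hP y.1 (δ i) := fun y t => by
    obtain ⟨ℓ, rfl⟩ := quotMk_surjective hP y.1 t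
    have hy := y.2 (rep y.1)
    have hℓ : ℓ = (ℓ (bas i₀) / val (bas i₀).1 (rep y.1).1) • evDual P (rep y.1).1 +
        ∑ i, fibDual hP y (ρ i y.1) (hρ i y) (quotMk hP y ℓ) • δ i := by
      refine bas.ext fun j => ?_
      rw [LinearMap.add_apply, LinearMap.smul_apply, evDual_apply, LinearMap.sum_apply]
      simp only [LinearMap.smul_apply, hpair, smul_eq_mul]
      rcases Fin.eq_self_or_eq_succAbove i₀ j with rfl | ⟨k, rfl⟩
      · simp only [hδ₀, mul_zero, Finset.sum_const_zero, add_zero]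
        field_simp
      · change ℓ (r k) = _ * val (r k).1 _ + ∑ i, _ * δ i (r k)
        simp only [hδ, mul_ite, mul_one, mul_zero, Finset.sum_ite_eq, Finset.mem_univ, if_true]
        ring
    conv_lhs => rw [hℓ, map_add, map_smul, quotMk_evDual hP, smul_zero, zero_add, map_sum]
    simp only [map_smul]
  refine ⟨U, (mem_basicOpen (rep x)).2 hi₀, fun i y => quotMk hP y.1 (δ i),
    fun i => quotMk_const_mem_reg hP U _, fun y => ⟨?_, ?_⟩, fun W h t ht => ?_⟩
  · rw [Fintype.linearIndependent_iff]
    intro g hg i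
    have := congrArg (fibDual hP y (ρ i y.1) (hρ i y)) hg
    simpa [hpair, hδ, hδ₀] using this
  · rw [eq_top_iff]
    intro t _
    rw [hexp y t]
    exact Submodule.sum_mem _ fun i _ =>
      Submodule.smul_mem _ _ (Submodule.subset_span ⟨i, rfl⟩)
  · refine ⟨fun i y => fibDual hP y (ρ i y.1) (hρ i ⟨y, h y.2⟩) (t y), fun i =>
      IsRegular.of_local fun y => ?_, fun y => hexp ⟨y, h y.2⟩ (t y)⟩
    obtain ⟨W', h', hy, σ, hσ, hst⟩ := mem_reg_EP.1 ht y
    refine ⟨W', h', hy, ?_⟩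
    have h1 := hσ (Dual.eval ℂ P (r i))
    have h2 := hσ (Dual.eval ℂ P (bas i₀))
    have h3 := isRegular_quot (hom (r i)) (hom (bas i₀)) (h'.trans h)
    convert h1.add ((IsRegular.const (-1)).mul (h3.mul h2)) using 2 with z
    have := hpair i ⟨z, h (h' z.2)⟩ (σ z)
    refine (congrArg (fibDual hP z (ρ i z) (hρ i ⟨z, h (h' z.2)⟩)) (hst z)).trans
      (this.trans ?_)
    rw [neg_one_mul, ← sub_eq_add_neg]
    rfl

theorem isDrezet_EP (hP : P ≤ Sym n c)
    (hbp : ∀ v : Fin (n + 1) → ℂ, v ≠ 0 → ∃ q ∈ P, val q v ≠ 0) {e : ℕ}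
    (bas : Basis (Fin (e + 1)) ℂ P) : (EP P hP).IsDrezet c e := by
  let Φ : Dual ℂ P ≃ₗ[ℂ] (Fin (e + 1) → ℂ) := bas.dualBasis.equivFun
  refine ⟨isVectorBundle_EP hP hbp bas,
    ⟨fun x => Φ.toLinearMap ∘ₗ evalMap P c x, fun U s hs ℓ =>
      (evalHom P hP).reg U s hs (ℓ ∘ₗ Φ.toLinearMap)⟩,
    ⟨fun x => quotMk hP x ∘ₗ Φ.symm.toLinearMap, fun U s hs => mem_reg_EP.2 fun x =>
      ⟨U, le_rfl, x.2, fun y => Φ.symm (s y), fun ℓ => hs (ℓ ∘ₗ Φ.symm.toLinearMap),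
        fun _ => rfl⟩⟩, fun x => ⟨?_, ?_, ?_⟩⟩
  · exact Φ.injective.comp (evalMap_injective hbp x)
  · intro w
    change quotMk hP x (Φ.symm w) = 0 ↔ ∃ φ, Φ (evalMap P c x φ) = w
    rw [← LinearMap.mem_ker, ker_quotMk hP (rep x), ← range_evalMap hP (rep x)]
    refine exists_congr fun φ => ?_
    exact LinearEquiv.eq_symm_apply Φ
  · exact (quotMk_surjective hP x).comp Φ.symm.surjective

end Bundle

/-! ### Sections of E_P^∨(1) as maps from the cone to P. -/

section DualTwist

variable {c : ℕ} {P : Submodule ℂ (MvPolynomial (Fin (n + 1)) ℂ)}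

/-- The pairing of a fibre of `E_P^∨(1)` with `P^∨`, for a vector of the line. -/
def pairing (hP : P ≤ Sym n c) {x : PP n} (v : Punct x) :
    ((EP P hP).dual.twist 1).fib x →ₗ[ℂ] Dual ℂ (Dual ℂ P) where
  toFun s := (show Dual ℂ ((EP P hP).fib x) from s.1 v) ∘ₗ quotMk hP x
  map_add' _ _ := rfl
  map_smul' _ _ := rfl

theorem pairing_smul (hP : P ≤ Sym n c) {x : PP n} {v w : Punct x} {k : ℂ} (h : k • v.1 = w.1)
    (s : ((EP P hP).dual.twist 1).fib x) (ℓ : Dual ℂ P) :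
    pairing hP w s ℓ = k * pairing hP v s ℓ := by
  have h1 : s.1 w = k ^ (1 : ℤ) • s.1 v := s.2 k v w h.symm
  rw [zpow_one] at h1
  exact LinearMap.congr_fun (congrArg (fun t : Dual ℂ ((EP P hP).fib x) => t ∘ₗ quotMk hP x) h1) ℓ

theorem pairing_evDual (hP : P ≤ Sym n c) {x : PP n} (v : Punct x)
    (s : ((EP P hP).dual.twist 1).fib x) : pairing hP v s (evDual P v.1) = 0 := by
  change (show Dual ℂ ((EP P hP).fib x) from s.1 v) (quotMk hP x (evDual P v.1)) = 0
  rw [quotMk_evDual, map_zero]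

theorem dual_fib_ext (hP : P ≤ Sym n c) {x : PP n} {s s' : Dual ℂ ((EP P hP).fib x)}
    (h : ∀ ℓ, s (quotMk hP x ℓ) = s' (quotMk hP x ℓ)) : s = s' := by
  refine LinearMap.ext fun t => ?_
  obtain ⟨ℓ, rfl⟩ := quotMk_surjective hP x t
  exact h ℓ

theorem pairing_ext (hP : P ≤ Sym n c) {x : PP n} {s s' : ((EP P hP).dual.twist 1).fib x}
    (h : ∀ v ℓ, pairing hP v s ℓ = pairing hP v s' ℓ) : s = s' :=
  Subtype.ext (funext fun v => dual_fib_ext hP (s := s.1 v) (s' := s'.1 v) (h v))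

theorem exists_fib_pairing_eq (hP : P ≤ Sym n c) {x : PP n} {g : Punct x → P}
    (hg : ∀ (k : ℂ) (v w : Punct x), w.1 = k • v.1 → g w = k • g v)
    (h0 : ∀ v, val (g v).1 v.1 = 0) :
    ∃ s : ((EP P hP).dual.twist 1).fib x, ∀ v ℓ, pairing hP v s ℓ = ℓ (g v) := by
  refine ⟨⟨fun v => fibDual hP x (g v) (val_rep_eq_zero hP (h0 v)), fun k v w h => ?_⟩,
    fun v ℓ => fibDual_quotMk hP x (g v) (val_rep_eq_zero hP (h0 v)) ℓ⟩
  rw [zpow_one]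
  refine dual_fib_ext hP (s := fibDual hP x (g w) (val_rep_eq_zero hP (h0 w)))
    (s' := k • fibDual hP x (g v) (val_rep_eq_zero hP (h0 v))) fun ℓ => ?_
  rw [LinearMap.smul_apply, fibDual_quotMk, fibDual_quotMk, hg k v w h, map_smul]

/-- P is reflexive, so an element of the fibre evaluated at v is a form of P. It vanishes at v
because the pairing kills evaluation at v. With `exists_fib_pairing_eq`, this identifies the fibre
with the forms of P that vanish at the point. -/
theorem exists_form_pairing_eq (hP : P ≤ Sym n c) {x : PP n}
    (s : ((EP P hP).dual.twist 1).fib x) (v : Punct x) :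
    ∃ p : P, val p.1 v.1 = 0 ∧ ∀ ℓ : Dual ℂ P, ℓ p = pairing hP v s ℓ := by
  have : FiniteDimensional ℂ P := finiteDimensional_of_le_sym hP
  obtain ⟨p, hp⟩ := (Module.evalEquiv ℂ P).surjective (pairing hP v s)
  have hp' : ∀ ℓ : Dual ℂ P, ℓ p = pairing hP v s ℓ := fun ℓ => by
    rw [← hp]
    rfl
  refine ⟨p, ?_, hp'⟩
  rw [← evDual_apply, hp', pairing_evDual]

/-- A regular section of `E_P^∨(1)`, as a map from the cone to `P`. -/
theorem exists_form_of_section (hP : P ≤ Sym n c) {U : Opens (PP n)}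
    {s : ∀ x : U, ((EP P hP).dual.twist 1).fib x} (hs : s ∈ ((EP P hP).dual.twist 1).reg U) :
    ∃ F : (Fin (n + 1) → ℂ) → P,
      (∀ (x : U) (v : Punct x.1) (ℓ : Dual ℂ P), ℓ (F v.1) = pairing hP v (s x) ℓ) ∧
      (∀ v ∈ cone U, val (F v).1 v = 0) ∧
      ∀ ℓ : Dual ℂ P, IsHomReg 1 (cone U) (fun v => ℓ (F v)) := by
  classical
  choose f hf0 hf using fun (x : U) (v : Punct x.1) => exists_form_pairing_eq hP (s x) v
  let F : (Fin (n + 1) → ℂ) → P := fun v =>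
    if h : v ∈ cone U then f ⟨_, h.2⟩ (toPunct h.1) else 0
  have hfmk : ∀ (y : PP n) (hy : y ∈ U) (x : U) (v : Punct x.1) (w : Punct y), y = x.1 →
      w.1 = v.1 → f ⟨y, hy⟩ w = f x v := by
    rintro y hy ⟨x, hx⟩ v w rfl h
    rw [Subtype.ext h]
  have hF : ∀ (x : U) (v : Punct x.1), F v.1 = f x v := fun x v => by
    simp only [F, dif_pos ((mem_cone v).2 x.2)]
    exact hfmk _ _ x v _ (mk_punct v) rfl
  have hpair : ∀ (x : U) (v : Punct x.1) (ℓ : Dual ℂ P), ℓ (F v.1) = pairing hP v (s x) ℓ :=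
    fun x v ℓ => by rw [hF, hf]
  refine ⟨F, hpair, fun v hv => ?_, fun ℓ => IsHomReg.of_local fun v hv => ?_⟩
  · obtain ⟨x, v, rfl⟩ := exists_punct_of_mem_cone hv
    rw [hF, hf0]
  · obtain ⟨x, v, rfl⟩ := exists_punct_of_mem_cone hv
    obtain ⟨W, h, hx, p, q, a, b, hpq, ha, hb, t, ht, H⟩ := hs x
    obtain rfl : p = q + 1 := by omega
    refine ⟨cone W, cone_mono h, (mem_cone v).2 hx, ?_⟩
    have h1 : IsHomReg 1 (cone W) (fun w => val a w / val b w) :=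
      IsHomReg.div ha hb (isOpenCone_cone W) fun w hw => by
        obtain ⟨y, w, rfl⟩ := exists_punct_of_mem_cone hw
        exact (H y w).2.1
    -- Pairing with the class of the constant section ℓ gives a regular function; the generator a /
    -- b of 𝒪(1) then supplies the degree one.
    have h2 : IsRegular (fun y : W => (show Dual ℂ ((EP P hP).fib y.1) from t y)
        (quotMk hP y.1 ℓ)) := ht W le_rfl _ (quotMk_const_mem_reg hP W ℓ)
    have hab : ∀ (y : W) (w : Punct y.1), ℓ (F w.1) = val a w.1 / val b w.1 *
        (show Dual ℂ ((EP P hP).fib y.1) from t y) (quotMk hP y.1 ℓ) := fun y w => by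
      rw [hpair ⟨y, h y.2⟩ w]
      exact LinearMap.congr_fun (congrArg (fun r : Dual ℂ ((EP P hP).fib y.1) =>
        r ∘ₗ quotMk hP y.1) (H y w).2.2) ℓ
    have hne : ∀ w ∈ cone W, val a w / val b w ≠ 0 := fun w hw => by
      obtain ⟨y, w, rfl⟩ := exists_punct_of_mem_cone hw
      exact div_ne_zero (H y w).1 (H y w).2.1
    have h3 : IsHomReg 0 (cone W) (fun w => ℓ (F w) / (val a w / val b w)) :=
      isHomReg_zero_of_isRegular (fun y w => by
        rw [hab y w, mul_div_cancel_left₀ _ (hne w.1 ((mem_cone w).2 y.2))]) h2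
    exact (h3.mul h1).congr fun w hw => div_mul_cancel₀ _ (hne w hw)

/-- A map from the cone to `P` that defines a regular section of `E_P^∨(1)`. -/
theorem exists_section_of_form (hP : P ≤ Sym n c) {U : Opens (PP n)}
    {F : (Fin (n + 1) → ℂ) → P} (h0 : ∀ v ∈ cone U, val (F v).1 v = 0)
    (hF : ∀ ℓ : Dual ℂ P, IsHomReg 1 (cone U) (fun v => ℓ (F v))) :
    ∃ s ∈ ((EP P hP).dual.twist 1).reg U,
      ∀ (x : U) (v : Punct x.1) (ℓ : Dual ℂ P), pairing hP v (s x) ℓ = ℓ (F v.1) := by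
  have : FiniteDimensional ℂ P := finiteDimensional_of_le_sym hP
  have hhom : ∀ (x : U) (k : ℂ) (v w : Punct x.1), w.1 = k • v.1 → F w.1 = k • F v.1 :=
    fun x k v w h => by
      rw [← sub_eq_zero, ← Module.forall_dual_apply_eq_zero_iff ℂ]
      intro ℓ
      rw [map_sub, map_smul, sub_eq_zero, h]
      have := (hF ℓ).smul_eq ((mem_cone v).2 x.2) v.2.2 (ne_zero_of_smul_eq_punct h.symm)
      rw [pow_one] at this
      exact this
  choose s hs using fun x : U => exists_fib_pairing_eq hP (g := fun v : Punct x.1 => F v.1)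
    (hhom x) fun v => h0 v.1 ((mem_cone v).2 x.2)
  refine ⟨s, fun x => ?_, hs⟩
  obtain ⟨i, hi⟩ := exists_ne_zero_of_ne_zero (rep x.1).2.2
  let D : Opens (PP n) := basicOpen (X i) (isHomogeneous_X ℂ i)
  have hD : ∀ {y : PP n}, y ∈ D → ∀ v : Punct y, v.1 i ≠ 0 := fun hy v => by
    simpa [val] using hy v
  refine ⟨U ⊓ D, inf_le_left, ⟨x.2, (mem_basicOpen (rep x.1)).2 (by simpa [val] using hi)⟩, 1, 0,
    X i, 1, by norm_num, isHomogeneous_X ℂ i, isHomogeneous_one _ _,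
    fun y => ((rep y.1).1 i)⁻¹ • (s ⟨y, y.2.1⟩).1 (rep y.1), ?_, fun y v => ⟨?_, ?_, ?_⟩⟩
  · intro W hW τ hτ
    refine IsRegular.of_local fun y => ?_
    obtain ⟨W', h', hy, σ, hσ, hst⟩ := mem_reg_EP.1 hτ y
    refine ⟨W', h', hy, ?_⟩
    -- On D(X i) the section is X i times F / X i. Its pairing with a local lift σ is the sum of the
    -- products σ(bas a) · (F_a / X i), with F_a the coordinates of F, and each factor is regular.
    let bas := Module.finBasis ℂ P
    have hreg : ∀ a, IsRegular (fun z : W' => bas.coord a (F (rep z.1).1) / (rep z.1).1 i) :=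
      fun a => by
        have h1 : IsHomReg 0 (cone W') (fun v => bas.coord a (F v) / v i) :=
          ((hF (bas.coord a)).mono (isOpenCone_cone W')
            (cone_mono (h'.trans (hW.trans inf_le_left)))).div_coord fun v hv => by
              obtain ⟨z, v, rfl⟩ := exists_punct_of_mem_cone hv
              exact hD (hW (h' z.2)).2 v
        refine isRegular_of_isHomReg_zero (fun z v => ?_) h1
        obtain ⟨k, hk⟩ := exists_smul_eq v (rep z.1)
        have hk0 := ne_zero_of_smul_eq_punct hk
        rw [hhom ⟨z, (hW (h' z.2)).1⟩ k v (rep z.1) hk.symm, map_smul, ← hk, smul_eq_mul,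
          Pi.smul_apply, smul_eq_mul, mul_div_mul_left _ _ hk0]
    have hsum := IsRegular.sum Finset.univ fun a _ => (hσ (Dual.eval ℂ P (bas a))).mul (hreg a)
    convert hsum using 2 with z
    have e1 : (show Dual ℂ ((EP P hP).fib z.1) from
        (s ⟨z, (hW (h' z.2)).1⟩).1 (rep z.1)) (τ ⟨z, h' z.2⟩) =
          (show Dual ℂ P from σ z) (F (rep z.1).1) := by
      rw [hst z]
      exact hs ⟨z, (hW (h' z.2)).1⟩ (rep z.1) (σ z)
    have e2 : ∀ m : Dual ℂ P, m (F (rep z.1).1) =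
        ∑ a, bas.coord a (F (rep z.1).1) * m (bas a) := fun m => by
      conv_lhs => rw [← bas.sum_repr (F (rep z.1).1), map_sum]
      simp only [map_smul, smul_eq_mul, Basis.coord_apply]
    refine (congrArg (fun r : ℂ => ((rep z.1).1 i)⁻¹ * r) (e1.trans (e2 _))).trans ?_
    rw [Finset.mul_sum]
    refine Finset.sum_congr rfl fun a _ => ?_
    change _ = (show Dual ℂ P from σ z) (bas a) * _
    ring
  · exact y.2.2 v
  · simp [val]
  · obtain ⟨k, hk⟩ := exists_smul_eq (rep y.1) v
    have h1 : (s ⟨y, y.2.1⟩).1 v = k ^ (1 : ℤ) • (s ⟨y, y.2.1⟩).1 (rep y.1) :=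
      (s ⟨y, y.2.1⟩).2 k (rep y.1) v hk.symm
    have hy := hD y.2.2 (rep y.1)
    rw [h1, zpow_one, smul_smul]
    congr 1
    simp only [val, eval_X, map_one, div_one, ← hk, Pi.smul_apply, smul_eq_mul]
    field_simp

end DualTwist

/-! ### Vanishing of H¹ and global generation. -/

theorem isHomReg_coord {C : Set (Fin (n + 1) → ℂ)} (hC : IsOpenCone C) (i : Fin (n + 1)) :
    IsHomReg 1 C (fun v => v i) :=
  (IsHomReg.poly (isHomogeneous_X ℂ i) hC).congr fun v _ => by simp [val]

theorem isHomReg_linear {C : Set (Fin (n + 1) → ℂ)} (hC : IsOpenCone C) (l : Fin (n + 1) → ℂ) :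
    IsHomReg 1 C (fun v => ∑ i, v i * l i) :=
  IsHomReg.sum _ hC fun i _ => ((isHomReg_coord hC i).const_mul (l i) hC).congr
    fun _ _ => mul_comm _ _

/-- The long exact sequence made explicit: a cocycle splits in P ⊗ 𝒪(1), and the splitting maps to a
global section of 𝒪(3), which lifts to V^∨ ⊗ P. -/
theorem h1Vanishes_dual_twist (hn : 1 ≤ n) (hT : T.IsSymm) (hk : 2 ≤ T.rank) :
    ((EP (orth T) (orth_le T)).dual.twist 1).H1Vanishes := by
  intro ι U hU
  have : FiniteDimensional ℂ (orth T) := finiteDimensional_of_le_sym (orth_le T)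
  rw [Submodule.Quotient.subsingleton_iff, eq_top_iff]
  rintro ⟨g, hg, hcoc⟩ -
  change ∃ f : ∀ (i : ι) (x : U i), ((EP (orth T) (orth_le T)).dual.twist 1).fib x, _
  choose F hFp hF0 hFr using fun i j => exists_form_of_section (orth_le T) (hg i j)
  let bas := Module.finBasis ℂ (orth T)
  have hC : ∀ i, IsOpenCone (cone (U i)) := fun i => isOpenCone_cone (U i)
  have hcov : ∀ v : Fin (n + 1) → ℂ, v ≠ 0 → ∃ i, v ∈ cone (U i) := fun v hv => by
    have : Projectivization.mk ℂ v hv ∈ ⨆ i, U i := by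
      rw [hU]
      trivial
    obtain ⟨i, hi⟩ := Opens.mem_iSup.1 this
    exact ⟨i, hv, hi⟩
  have hsplit : ∀ a, ∃ B : ι → (Fin (n + 1) → ℂ) → ℂ, (∀ i, IsHomReg 1 (cone (U i)) (B i)) ∧
      ∀ i j, ∀ v ∈ cone (U i), v ∈ cone (U j) → bas.coord a (F i j v) = B j v - B i v := fun a => by
    refine exists_isHomReg_eq_sub hn hC (fun i v hv => hv.1) hcov
      (G := fun i j v => bas.coord a (F i j v)) (fun i j => ?_) fun i j k v hi hj hk => ?_
    · rw [← cone_inf]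
      exact hFr i j _
    · obtain ⟨x, v, rfl⟩ := exists_punct_of_mem_cone hi
      have hxj := (mem_cone v).1 hj
      have hxk := (mem_cone v).1 hk
      rw [hFp i j ⟨x, x.2, hxj⟩ v, hFp j k ⟨x, hxj, hxk⟩ v, hFp i k ⟨x, x.2, hxk⟩ v,
        ← hcoc i j k x x.2 hxj hxk, map_add, LinearMap.add_apply]
  choose B hB hBF using hsplit
  have hFB : ∀ i j, ∀ v ∈ cone (U i), v ∈ cone (U j) →
      F i j v = ∑ a, B a j v • bas a - ∑ a, B a i v • bas a := fun i j v hi hj => by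
    conv_lhs => rw [← bas.sum_repr (F i j v)]
    rw [← Finset.sum_sub_distrib]
    refine Finset.sum_congr rfl fun a _ => ?_
    rw [← Basis.coord_apply, hBF a i j v hi hj]
    refine Subtype.ext ?_
    rw [Submodule.coe_sub, Submodule.coe_smul, Submodule.coe_smul, Submodule.coe_smul, sub_smul]
  -- the images in `𝒪(3)` glue to a cubic form
  let h : ι → (Fin (n + 1) → ℂ) → ℂ := fun i v => val (∑ a, B a i v • bas a : orth T).1 v
  have hh : ∀ i, IsHomReg 3 (cone (U i)) (h i) := fun i => by
    have := IsHomReg.sum (d := 3) Finset.univ (hC i) fun a _ =>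
      (hB a i).mul (IsHomReg.poly (isHomogeneous_of_mem (orth_le T) (bas a)) (hC i))
    refine this.congr fun v _ => ?_
    simp [h, val, smul_eval]
  have hhij : ∀ i j, ∀ v ∈ cone (U i), v ∈ cone (U j) → h i v = h j v := fun i j v hi hj => by
    have h1 := hF0 i j v (by rw [cone_inf]; exact ⟨hi, hj⟩)
    rw [hFB i j v hi hj, Submodule.coe_sub] at h1
    simp only [val, map_sub] at h1
    exact (sub_eq_zero.1 h1).symm
  have : Nonempty ι := ⟨(hcov (Pi.single 0 1) (by simp)).choose⟩
  choose! idx hidx using hcov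
  obtain ⟨A, hA, hhA⟩ := IsHomReg.exists_eq_val (d := 3) (F := fun v => h (idx v) v) hn
    (IsHomReg.of_local fun v hv => ⟨cone (U (idx v)), fun w hw => hw.1, hidx v hv,
      (hh (idx v)).congr fun w hw => hhij _ _ w hw (hidx w hw.1)⟩)
  obtain ⟨p, hp⟩ := sym_three_le_range_mulMap hT hk ((mem_homogeneousSubmodule _ _).2 hA)
  rw [mulMap_apply] at hp
  -- The cubic is A = ∑ X_l p_l. Subtracting the global map v ↦ ∑ v_l p_l leaves the differences
  -- unchanged and makes the form at v vanish at v, as a section of E_P^∨(1) requires.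
  let B' : ι → (Fin (n + 1) → ℂ) → orth T := fun i v => ∑ a, B a i v • bas a - ∑ l, v l • p l
  choose f hf hfB using fun i => exists_section_of_form (orth_le T) (U := U i) (F := B' i)
    (fun v hv => by
      have h1 : h i v = val A v := (hhij i _ v hv (hidx v hv.1)).trans (hhA v hv.1)
      have h2 : val (∑ l, v l • p l : orth T).1 v = val A v := by
        rw [← hp]
        simp [val, smul_eval]
      simp only [B', Submodule.coe_sub]
      simp only [h] at h1
      simp only [val, map_sub] at h1 h2 ⊢
      rw [h1, h2, sub_self])
    (fun ℓ => by
      have h1 := IsHomReg.sum Finset.univ (hC i) fun a _ => (hB a i).const_mul (ℓ (bas a)) (hC i)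
      refine (h1.sub (hC i) (isHomReg_linear (hC i) fun l => ℓ (p l))).congr fun v _ => ?_
      simp [B', mul_comm])
  suffices hgf : ∀ (i j : ι) (x : PP n) (hi : x ∈ U i) (hj : x ∈ U j),
      g i j ⟨x, hi, hj⟩ = f j ⟨x, hj⟩ - f i ⟨x, hi⟩ from ⟨f, hf, hgf⟩
  intro i j x hi hj
  refine pairing_ext (orth_le T) fun v ℓ => ?_
  have h1 := hFB i j v.1 ((mem_cone v).2 hi) ((mem_cone v).2 hj)
  rw [map_sub, LinearMap.sub_apply, hfB i ⟨x, hi⟩ v, hfB j ⟨x, hj⟩ v, ← map_sub,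
    ← hFp i j ⟨x, hi, hj⟩ v, h1]
  congr 1
  simp only [B']
  abel

/-- A linear syzygy r defines the global section v ↦ ∑ v_i r_i, so by `exists_syzygy` every fibre
element is itself the value of a section. -/
theorem isGloballyGenerated_dual_twist (hT : T.IsSymm) (hk : 3 ≤ T.rank) :
    ((EP (orth T) (orth_le T)).dual.twist 1).IsGloballyGenerated := by
  intro x
  rw [eq_top_iff]
  intro φ _
  refine Submodule.subset_span ?_
  obtain ⟨p, hp0, hp⟩ := exists_form_pairing_eq (orth_le T) φ (rep x)
  obtain ⟨r, hr, hrp⟩ := exists_syzygy hT hk (rep x).2.2 p.2 hp0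
  have hrp' : ∑ i, (rep x).1 i • r i = p := Subtype.ext (by simpa using hrp)
  obtain ⟨s, hs, hsF⟩ := exists_section_of_form (orth_le T) (U := ⊤)
    (F := fun v => ∑ i, v i • r i)
    (fun v _ => by
      have := congrArg (eval v) hr
      simpa [val, smul_eval] using this)
    (fun ℓ => (isHomReg_linear (isOpenCone_cone ⊤) fun i => ℓ (r i)).congr fun v _ => by simp)
  refine ⟨s, hs, pairing_ext (orth_le T) fun v ℓ => ?_⟩
  obtain ⟨k, hk⟩ := exists_smul_eq (rep x) v
  rw [hsF ⟨x, Opens.mem_top x⟩ v, pairing_smul (orth_le T) hk, ← hp ℓ, ← hrp', ← hk]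
  simp only [map_sum, map_smul, Pi.smul_apply, smul_eq_mul, Finset.mul_sum, mul_assoc]

theorem not_isGloballyGenerated_dual_twist (hn : 1 ≤ n) (hT : T.IsSymm) (hk : T.rank = 2) :
    ¬ ((EP (orth T) (orth_le T)).dual.twist 1).IsGloballyGenerated := by
  intro hgg
  obtain ⟨a, b, ha, hb, hab⟩ := exists_eq_add_of_rank_eq_two hT hk
  obtain ⟨p, hp, hpa, hpb⟩ := exists_mem_orth_of_eq_add hT hab hb
  obtain ⟨i, hi⟩ := exists_ne_zero_of_ne_zero ha
  let x := Projectivization.mk ℂ a ha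
  let v : Punct x := toPunct ha
  obtain ⟨φ, hφ⟩ := exists_fib_pairing_eq (orth_le T) (x := x)
    (g := fun w => (w.1 i / a i) • ⟨p, hp⟩)
    (fun k u w h => by
      rw [h, Pi.smul_apply, smul_eq_mul, mul_div_assoc, mul_smul])
    (fun w => by
      obtain ⟨k, hk⟩ := exists_smul_eq v w
      have hk' : k • a = w.1 := hk
      have : val p w.1 = 0 := by
        rw [← hk', val_smul (isHomogeneous_of_mem (orth_le T) ⟨p, hp⟩), hpa, mul_zero]
      simp only [val] at this
      simp [val, smul_eval, this])
  have hφb : pairing (orth_le T) v φ (evDual _ b) = val p b := by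
    rw [hφ, map_smul, evDual_apply, show v.1 i = a i from rfl, div_self hi, one_smul]
  -- The value at b of the quadric that represents a fibre element at [a]: it vanishes on all global
  -- sections, but not on φ.
  let Λ := (LinearMap.applyₗ (R := ℂ) (evDual (orth T) b)) ∘ₗ pairing (orth_le T) v
  have hle : Submodule.span ℂ {e : ((EP (orth T) (orth_le T)).dual.twist 1).fib x |
      ∃ s ∈ ((EP (orth T) (orth_le T)).dual.twist 1).reg ⊤, s ⟨x, Opens.mem_top x⟩ = e} ≤
        LinearMap.ker Λ := by
    rw [Submodule.span_le]
    rintro _ ⟨s, hs, rfl⟩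
    obtain ⟨F, hFp, hF0, hFr⟩ := exists_form_of_section (orth_le T) hs
    rw [cone_top] at hF0 hFr
    have hadd : a + b ≠ 0 := fun h => hb (by
      rw [eq_neg_of_add_eq_zero_right h]
      exact Submodule.neg_mem _ (Submodule.mem_span_singleton_self a))
    have hsub : a - b ≠ 0 := fun h => hb (by
      rw [← sub_eq_zero.1 h]
      exact Submodule.mem_span_singleton_self a)
    have hb0 : b ≠ 0 := fun h => hb (by rw [h]; exact Submodule.zero_mem _)
    have : FiniteDimensional ℂ (orth T) := finiteDimensional_of_le_sym (orth_le T)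
    -- The coordinates of F are linear forms, but only away from the origin, so additivity is used
    -- only among nonzero vectors.
    have hFadd : ∀ u w, u ≠ 0 → w ≠ 0 → u + w ≠ 0 → F (u + w) = F u + F w := fun u w hu hw huw => by
      rw [← sub_eq_zero, ← Module.forall_dual_apply_eq_zero_iff ℂ]
      intro ℓ
      obtain ⟨A, hA, hFA⟩ := (hFr ℓ).exists_eq_val hn
      rw [map_sub, map_add, hFA _ hu, hFA _ hw, hFA _ huw, val_add_of_mem_sym_one hA, sub_self]
    have h1 := hFadd a b ha hb0 hadd
    have h2 := hFadd (a - b) b hsub hb0 (by simpa using ha)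
    rw [sub_add_cancel] at h2
    have h3 : F (a - b) = F a - F b := eq_sub_of_add_eq h2.symm
    have e0 := hF0 a ha
    have e1 := hF0 _ hadd
    have e2 := hF0 _ hsub
    -- Without mixed terms, F(v)(v) = 0 at a ± b reads (F(a) ± F(b))(a) + (F(a) ± F(b))(b) = 0.
    -- Adding the two and using F(a)(a) = 0 leaves F(a)(b) = 0.
    have q1 := val_add_smul_of_mem_orth hT hab (F (a + b)).2 1
    have q2 := val_add_smul_of_mem_orth hT hab (F (a - b)).2 (-1)
    rw [one_smul, e1, h1, Submodule.coe_add] at q1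
    rw [neg_one_smul, ← sub_eq_add_neg, e2, h3, Submodule.coe_sub] at q2
    change pairing (orth_le T) v (s ⟨x, Opens.mem_top x⟩) (evDual _ b) = 0
    rw [← hFp ⟨x, Opens.mem_top x⟩ v, evDual_apply]
    change val (F a).1 b = 0
    simp only [val, map_add, map_sub] at e0 q1 q2 ⊢
    linear_combination (-1 / 2 : ℂ) * q1 - q2 / 2 - e0
  rw [hgg x] at hle
  have : Λ φ = 0 := hle (Submodule.mem_top (x := φ))
  exact hpb (hφb.symm.trans this)

end Drezet

end

theorem mainTheorem4 (n k : ℕ) (T : Matrix (Fin (n + 1)) (Fin (n + 1)) ℂ) (hT : T.IsSymm)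
    (hrank : T.rank = k) (hk : 2 ≤ k) :
    (∃ e : ℕ, Module.finrank ℂ (Drezet.orth T) = e + 1 ∧
      (Drezet.EP (Drezet.orth T) (Drezet.orth_le T)).IsOrdinaryDrezet 2 e) ∧
    (((Drezet.EP (Drezet.orth T) (Drezet.orth_le T)).dual.twist 1).IsGloballyGenerated ↔
      2 < k) := by
  subst hrank
  have hn : 1 ≤ n := by
    have := T.rank_le_card_width
    rw [Fintype.card_fin] at this
    omega
  have hbp : ∀ v : Fin (n + 1) → ℂ, v ≠ 0 → ∃ q ∈ Drezet.orth T, Drezet.val q v ≠ 0 :=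
    fun v hv => Drezet.exists_mem_orth_val_ne_zero hT hk hv
  have : FiniteDimensional ℂ (Drezet.orth T) :=
    Drezet.finiteDimensional_of_le_sym (Drezet.orth_le T)
  have hpos : 0 < Module.finrank ℂ (Drezet.orth T) := by
    obtain ⟨q, hq, hqv⟩ := hbp (Pi.single 0 1) (by simp)
    have : Nontrivial (Drezet.orth T) := ⟨⟨q, hq⟩, 0, fun h => hqv (by
      rw [show q = 0 from congrArg Subtype.val h]
      simp [Drezet.val])⟩
    exact Module.finrank_pos
  obtain ⟨e, he⟩ := Nat.exists_eq_succ_of_ne_zero hpos.ne'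
  refine ⟨⟨e, he, Drezet.isDrezet_EP _ hbp (Module.finBasisOfFinrankEq ℂ _ he),
    Drezet.h1Vanishes_dual_twist hn hT hk⟩, fun hgg => ?_, fun h =>
    Drezet.isGloballyGenerated_dual_twist hT h⟩
  by_contra hle
  exact Drezet.not_isGloballyGenerated_dual_twist hn hT (by omega) hgg
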